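/- **Setting.** Let $d\ge 1$. For $\alpha\in\mathbf N^d$ let $h_\alpha(x)=\pi^{-d/4}(-1)^{|\alpha|}(2^{|\alpha|}\alpha!)^{-1/2}e^{|x|^2/2}\,\partial^\alpha e^{-|x|^2}$ be the Hermite functions on $\mathbf R^d$, and let $\mathcal H_0'(\mathbf R^d)$ be the space of all formal Hermite series $\sum_{\alpha\in\mathbf N^d} c(\alpha)h_\alpha$ with $c(\alpha)\in\mathbf C$. Let $\mathcal S_{1/2}(\mathbf R^d)=\bigcup_{h>0}\mathcal S_{1/2,h}(\mathbf R^d)$ be the Gelfand–Shilov space, where $\mathcal S_{1/2,h}(\mathbf R^d)$ is the Banach space of all smooth $f:\mathbf R^d\to\mathbf C$ with $$\sup_{\alpha,\beta\in\mathbf N^d,\;x\in\mathbf R^d}\frac{|x^\beta\partial^\alpha f(x)|}{h^{|\alpha|+|\beta|}(\alpha!\,\beta!)^{1/2}}<\infty ,$$ equipped with the locally convex inductive limit topology, and let $\mathcal S_{1/2}'(\mathbf R^d)$ be its strong dual. Each $f\in\mathcal S_{1/2}(\mathbf R^d)$ and each $u\in\mathcal S_{1/2}'(\mathbf R^d)$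 is identified with its Hermite series in $\mathcal H_0'(\mathbf R^d)$, with coefficients $\int f\,\overline{h_\alpha}\,dx$ and $u(h_\alpha)$, respectively. Let $\mathcal H_{0,1/2}'(\mathbf R^d)$ be the set of all $\sum_\alpha c(\alpha)h_\alpha\in\mathcal H_0'(\mathbf R^d)$ such that $|c(\alpha)|\le Ce^{r|\alpha|}$ for some $C,r>0$ and all $\alpha$, and let $\mathcal H_0(\mathbf R^d)\subseteq\mathcal S_{1/2}(\mathbf R^d)$ be the set of finite linear combinations of Hermite functions. For $\varrho=(\varrho_1,\dots,\varrho_d)\in\mathbf C^d$, the fractional Fourier transform $\mathscr F_\varrho$ of multiple order $\varrho$ on $\mathcal H_0'(\mathbf R^d)$ is defined by $(\mathfrak V_d\mathscr F_\varrho f)(z)=(\mathfrak V_df)(e^{-i\pi\varrho_1/2}z_1,\dots,e^{-i\pi\varrho_d/2}z_d)$, where the Bargmann transform $\mathfrak V_d$ maps $\sum_\alpha c(\alpha)h_\alpha$ to the formal power series $\sum_\alpha c(\alpha)z^\alpha/\sqrt{\alpha!}$. Moreover, $H_{x,\varrho}=\sum_{j}\varrho_j(x_j^2-\partial_{x_j}^2)$,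 which has $h_\alpha$ as eigenfunction with eigenvalue $\sum_j\varrho_j(2\alpha_j+1)$, and $e^{-i\frac\pi4H_{x,\varrho}}$ is the operator on $\mathcal H_0'(\mathbf R^d)$ which multiplies the coefficient of $h_\alpha$ by $\exp(-i\frac\pi4\sum_j\varrho_j(2\alpha_j+1))$. An operator $A$ on $\mathcal H_0'(\mathbf R^d)$ is called discontinuous from $\mathcal S_{1/2}(\mathbf R^d)$ to $\mathcal S_{1/2}'(\mathbf R^d)$ if there is no set $D$ with $\mathcal H_0(\mathbf R^d)\subseteq D\subseteq\mathcal S_{1/2}(\mathbf R^d)$ such that $A(D)\subseteq\mathcal S_{1/2}'(\mathbf R^d)$ and $A:D\to\mathcal S_{1/2}'(\mathbf R^d)$ is continuous for the topology of $\mathcal S_{1/2}(\mathbf R^d)$ on $D$. **Proposition.** Let $\varrho\in\mathbf C^d$. Then the following is true: 1. If $\operatorname{Im}\varrho_j<0$ for every $j$, then $\mathscr F_\varrho$ and $e^{-i\frac\pi4H_{x,\varrho}}$ are continuous from $\mathcal S_{1/2}'(\mathbf R^d)$ to $\mathcal S_{1/2}(\mathbf R^d)$, and $$\mathscr F_\varrho(\mathcal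 S_{1/2}'(\mathbf R^d))=e^{-i\frac\pi4H_{x,\varrho}}(\mathcal S_{1/2}'(\mathbf R^d))\subsetneq\mathcal S_{1/2}(\mathbf R^d).$$ 2. If $\operatorname{Im}\varrho_j>0$ for every $j$, then $\mathscr F_\varrho$ and $e^{-i\frac\pi4H_{x,\varrho}}$ are discontinuous from $\mathcal S_{1/2}(\mathbf R^d)$ to $\mathcal S_{1/2}'(\mathbf R^d)$, and $$\mathcal S_{1/2}'(\mathbf R^d)\subsetneq\mathscr F_\varrho(\mathcal S_{1/2}(\mathbf R^d))=e^{-i\frac\pi4H_{x,\varrho}}(\mathcal S_{1/2}(\mathbf R^d))\subsetneq\mathcal H_{0,1/2}'(\mathbf R^d).$$ 3. If $\operatorname{Im}\varrho_j>0$ for some $j$, then $\mathscr F_\varrho$ and $e^{-i\frac\pi4H_{x,\varrho}}$ are discontinuous from $\mathcal S_{1/2}(\mathbf R^d)$ to $\mathcal S_{1/2}'(\mathbf R^d)$, and there is an $f\in\mathcal S_{1/2}(\mathbf R^d)$ such that both $\mathscr F_\varrho f$ and $e^{-i\frac\pi4H_{x,\varrho}}f$ belong to $\mathcal H_{0,1/2}'(\mathbf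 R^d)\setminus\mathcal S_{1/2}'(\mathbf R^d)$. -/

import Mathlib

open scoped Nat ENNReal NNReal ContDiff

namespace FracFourier

/-! ### Multi-indices, monomials and partial derivatives -/

/-- Multi-indices in `ℕ^d`; the length `|α|` is Mathlib's `Finsupp.degree α = ∑ j, α j`. -/
abbrev MultiIndex (d : ℕ) : Type := Fin d →₀ ℕ

/-- `α! = α₁! ⋯ α_d!`. -/
def mfact {d : ℕ} (α : MultiIndex d) : ℕ := ∏ j, (α j)!

/-- `x^β = x₁^β₁ ⋯ x_d^β_d`. -/
def monom {d : ℕ} (β : MultiIndex d) (x : Fin d → ℝ) : ℝ := ∏ j, x j ^ β j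

/-- The partial derivative `∂_j f`. Points of `ℝ^d` are `Fin d → ℝ`; only coordinates, derivatives
and Lebesgue measure on this space are used below, never its norm. -/
noncomputable def partialDeriv {d : ℕ} (j : Fin d) (f : (Fin d → ℝ) → ℂ) : (Fin d → ℝ) → ℂ :=
  fun x => lineDeriv ℝ f x (Pi.single j 1)

/-- `∂^α f = ∂_1^α₁ ⋯ ∂_d^α_d f`. -/
noncomputable def iteratedPartial {d : ℕ} (α : MultiIndex d) (f : (Fin d → ℝ) → ℂ) :
    (Fin d → ℝ) → ℂ :=
  (List.finRange d).foldr (fun j g => (partialDeriv j)^[α j] g) f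

/-! ### Gelfand–Shilov spaces -/

/-- The extended norm of `𝒮_{s,h}(ℝ^d)`:
`sup_{α, β, x} |x^β ∂^α f(x)| / (h^{|α|+|β|} (α! β!)^s)`. -/
noncomputable def gsNorm {d : ℕ} (s h : ℝ) (f : (Fin d → ℝ) → ℂ) : ℝ≥0∞ :=
  ⨆ (α : MultiIndex d) (β : MultiIndex d) (x : Fin d → ℝ),
    ENNReal.ofReal (‖(monom β x : ℂ) * iteratedPartial α f x‖ /
      (h ^ (α.degree + β.degree) * ((mfact α : ℝ) * (mfact β : ℝ)) ^ s))

theorem gsNorm_le_iff {d : ℕ} {s h : ℝ} {f : (Fin d → ℝ) → ℂ} {C : ℝ≥0∞} :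
    gsNorm s h f ≤ C ↔ ∀ (α β : MultiIndex d) (x : Fin d → ℝ),
      ENNReal.ofReal (‖(monom β x : ℂ) * iteratedPartial α f x‖ /
        (h ^ (α.degree + β.degree) * ((mfact α : ℝ) * (mfact β : ℝ)) ^ s)) ≤ C := by
  simp only [gsNorm, iSup_le_iff]

theorem mfact_pos {d : ℕ} (α : MultiIndex d) : (0 : ℝ) < mfact α := by
  have : 0 < mfact α := Finset.prod_pos fun j _ => Nat.factorial_pos _
  exact_mod_cast this

theorem gsNorm_anti {d : ℕ} {s h h' : ℝ} (hh : 0 < h) (hle : h ≤ h') (f : (Fin d → ℝ) → ℂ) :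
    gsNorm s h' f ≤ gsNorm s h f := by
  rw [gsNorm_le_iff]
  intro α β x
  refine le_trans (ENNReal.ofReal_le_ofReal ?_) (gsNorm_le_iff.1 le_rfl α β x)
  have h0 : (0 : ℝ) < ((mfact α : ℝ) * (mfact β : ℝ)) ^ s :=
    Real.rpow_pos_of_pos (mul_pos (mfact_pos α) (mfact_pos β)) s
  gcongr

theorem partialDeriv_eq {d : ℕ} (j : Fin d) {f : (Fin d → ℝ) → ℂ} (hf : ContDiff ℝ ∞ f) :
    partialDeriv j f = fun x => fderiv ℝ f x (Pi.single j 1) := by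
  funext x
  exact ((hf.differentiable (by simp)) x).lineDeriv_eq_fderiv

theorem contDiff_partialDeriv {d : ℕ} (j : Fin d) {f : (Fin d → ℝ) → ℂ} (hf : ContDiff ℝ ∞ f) :
    ContDiff ℝ ∞ (partialDeriv j f) := by
  rw [partialDeriv_eq j hf]
  exact (hf.fderiv_right (m := ∞) (by simp)).clm_apply contDiff_const

theorem partialDeriv_add {d : ℕ} (j : Fin d) {f g : (Fin d → ℝ) → ℂ} (hf : ContDiff ℝ ∞ f)
    (hg : ContDiff ℝ ∞ g) : partialDeriv j (f + g) = partialDeriv j f + partialDeriv j g := by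
  rw [partialDeriv_eq j hf, partialDeriv_eq j hg,
    partialDeriv_eq j (show ContDiff ℝ ∞ (f + g) from hf.add hg)]
  funext x
  rw [fderiv_add ((hf.differentiable (by simp)) x) ((hg.differentiable (by simp)) x)]
  rfl

theorem partialDeriv_smul {d : ℕ} (j : Fin d) (c : ℂ) {f : (Fin d → ℝ) → ℂ}
    (hf : ContDiff ℝ ∞ f) : partialDeriv j (c • f) = c • partialDeriv j f := by
  rw [partialDeriv_eq j hf, partialDeriv_eq j
    (show ContDiff ℝ ∞ (c • f) from contDiff_const.smul hf)]
  funext x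
  rw [fderiv_const_smul ((hf.differentiable (by simp)) x)]
  rfl

theorem iterate_partialDeriv_lin {d : ℕ} (j : Fin d) (n : ℕ) (c : ℂ) {f g : (Fin d → ℝ) → ℂ}
    (hf : ContDiff ℝ ∞ f) (hg : ContDiff ℝ ∞ g) :
    ContDiff ℝ ∞ ((partialDeriv j)^[n] f) ∧
      (partialDeriv j)^[n] (f + g) = (partialDeriv j)^[n] f + (partialDeriv j)^[n] g ∧
      (partialDeriv j)^[n] (c • f) = c • (partialDeriv j)^[n] f := by
  induction n generalizing f g with
  | zero => exact ⟨hf, rfl, rfl⟩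
  | succ n ih =>
    simp only [Function.iterate_succ_apply, partialDeriv_add j hf hg, partialDeriv_smul j c hf]
    exact ih (contDiff_partialDeriv j hf) (contDiff_partialDeriv j hg)

theorem iteratedPartial_lin {d : ℕ} (α : MultiIndex d) (c : ℂ) {f g : (Fin d → ℝ) → ℂ}
    (hf : ContDiff ℝ ∞ f) (hg : ContDiff ℝ ∞ g) :
    iteratedPartial α (f + g) = iteratedPartial α f + iteratedPartial α g ∧
      iteratedPartial α (c • f) = c • iteratedPartial α f := by
  have key : ∀ l : List (Fin d),
      ContDiff ℝ ∞ (l.foldr (fun j g => (partialDeriv j)^[α j] g) f) ∧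
      ContDiff ℝ ∞ (l.foldr (fun j g => (partialDeriv j)^[α j] g) g) ∧
      l.foldr (fun j g => (partialDeriv j)^[α j] g) (f + g) =
        l.foldr (fun j g => (partialDeriv j)^[α j] g) f +
          l.foldr (fun j g => (partialDeriv j)^[α j] g) g ∧
      l.foldr (fun j g => (partialDeriv j)^[α j] g) (c • f) =
        c • l.foldr (fun j g => (partialDeriv j)^[α j] g) f := by
    intro l
    induction l with
    | nil => exact ⟨hf, hg, rfl, rfl⟩
    | cons j l ih =>
      obtain ⟨h1, h2, h3, h4⟩ := ih
      simp only [List.foldr_cons, h3, h4]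
      have A := iterate_partialDeriv_lin j (α j) c h1 h2
      exact ⟨A.1, (iterate_partialDeriv_lin j (α j) c h2 h1).1, A.2.1, A.2.2⟩
  exact ⟨(key _).2.2.1, (key _).2.2.2⟩

theorem gsNorm_add_le {d : ℕ} {s h : ℝ} (hh : 0 < h) {f g : (Fin d → ℝ) → ℂ}
    (hf : ContDiff ℝ ∞ f) (hg : ContDiff ℝ ∞ g) :
    gsNorm s h (f + g) ≤ gsNorm s h f + gsNorm s h g := by
  rw [gsNorm_le_iff]
  intro α β x
  have h0 : (0 : ℝ) < ((mfact α : ℝ) * (mfact β : ℝ)) ^ s :=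
    Real.rpow_pos_of_pos (mul_pos (mfact_pos α) (mfact_pos β)) s
  refine le_trans ?_ (add_le_add (gsNorm_le_iff.1 le_rfl α β x) (gsNorm_le_iff.1 le_rfl α β x))
  rw [← ENNReal.ofReal_add (by positivity) (by positivity), ← add_div,
    (iteratedPartial_lin α 0 hf hg).1, Pi.add_apply, mul_add]
  refine ENNReal.ofReal_le_ofReal ?_
  gcongr
  exact norm_add_le _ _

theorem gsNorm_smul_le {d : ℕ} {s h : ℝ} (c : ℂ) {f : (Fin d → ℝ) → ℂ}
    (hf : ContDiff ℝ ∞ f) :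
    gsNorm s h (c • f) ≤ ENNReal.ofReal ‖c‖ * gsNorm s h f := by
  rw [gsNorm_le_iff]
  intro α β x
  refine le_trans (le_of_eq ?_) (mul_le_mul_right (gsNorm_le_iff.1 le_rfl α β x) _)
  rw [← ENNReal.ofReal_mul (norm_nonneg _), (iteratedPartial_lin α c hf hf).2, Pi.smul_apply,
    smul_eq_mul, mul_left_comm, norm_mul c, mul_div_assoc]

/-- The vector space `𝒮_s(ℝ^d) = ⋃_{h > 0} 𝒮_{s,h}(ℝ^d)`, where `𝒮_{s,h}(ℝ^d)` consists of the
smooth functions with finite `𝒮_{s,h}`-norm. -/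
def gsSubmodule (s : ℝ) (d : ℕ) : Submodule ℂ ((Fin d → ℝ) → ℂ) where
  carrier := {f | ContDiff ℝ ∞ f ∧ ∃ h : ℝ, 0 < h ∧ gsNorm s h f < ⊤}
  zero_mem' := by
    refine ⟨contDiff_const, 1, one_pos, ?_⟩
    have : gsNorm s 1 (0 : (Fin d → ℝ) → ℂ) ≤ 0 := by
      have := gsNorm_smul_le (d := d) (s := s) (h := 1) 0 (f := 0) contDiff_const
      simpa using this
    exact lt_of_le_of_lt this (by simp)
  add_mem' := by
    rintro f g ⟨hf, h, hh, hfn⟩ ⟨hg, k, hk, hgn⟩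
    refine ⟨hf.add hg, max h k, lt_max_of_lt_left hh, ?_⟩
    refine lt_of_le_of_lt (gsNorm_add_le (lt_max_of_lt_left hh) hf hg) (ENNReal.add_lt_top.2 ⟨?_, ?_⟩)
    · exact lt_of_le_of_lt (gsNorm_anti hh (le_max_left _ _) f) hfn
    · exact lt_of_le_of_lt (gsNorm_anti hk (le_max_right _ _) g) hgn
  smul_mem' := by
    rintro c f ⟨hf, h, hh, hfn⟩
    exact ⟨contDiff_const.smul hf, h, hh,
      lt_of_le_of_lt (gsNorm_smul_le c hf) (ENNReal.mul_lt_top ENNReal.ofReal_lt_top hfn)⟩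

/-- The Gelfand–Shilov space `𝒮_s(ℝ^d)` (Roumieu type). It is a separate type because its topology
is not the topology of pointwise convergence. -/
def GelfandShilov (s : ℝ) (d : ℕ) : Type := ↥(gsSubmodule s d)

noncomputable instance (s : ℝ) (d : ℕ) : AddCommGroup (GelfandShilov s d) :=
  inferInstanceAs (AddCommGroup ↥(gsSubmodule s d))

noncomputable instance (s : ℝ) (d : ℕ) : Module ℂ (GelfandShilov s d) :=
  inferInstanceAs (Module ℂ ↥(gsSubmodule s d))

/-- The underlying function of an element of `𝒮_s(ℝ^d)`. -/
def GelfandShilov.toFun {s : ℝ} {d : ℕ} (f : GelfandShilov s d) : (Fin d → ℝ) → ℂ := f.1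

/-- The seminorms on `𝒮_s(ℝ^d)` whose restriction to each Banach space `𝒮_{s,h}(ℝ^d)`, `h > 0`, is
continuous, that is, bounded by a multiple of the norm of `𝒮_{s,h}(ℝ^d)`. -/
def IsLimitSeminorm {s : ℝ} {d : ℕ} (p : Seminorm ℂ (GelfandShilov s d)) : Prop :=
  ∀ h : ℝ, 0 < h → ∃ C : ℝ≥0, ∀ f : GelfandShilov s d,
    gsNorm s h f.toFun < ⊤ → ENNReal.ofReal (p f) ≤ C * gsNorm s h f.toFun

/-- The family of all such seminorms. -/
def limitSeminorms (s : ℝ) (d : ℕ) :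
    SeminormFamily ℂ (GelfandShilov s d)
      {p : Seminorm ℂ (GelfandShilov s d) // IsLimitSeminorm p} :=
  fun p => p.1

/-- The topology of `𝒮_s(ℝ^d)`: the locally convex inductive limit of the Banach spaces
`𝒮_{s,h}(ℝ^d)`, `h > 0`, that is, the finest locally convex topology for which all the inclusions
`𝒮_{s,h}(ℝ^d) → 𝒮_s(ℝ^d)` are continuous. -/
noncomputable instance (s : ℝ) (d : ℕ) : TopologicalSpace (GelfandShilov s d) :=
  (limitSeminorms s d).moduleFilterBasis.topology

theorem withSeminorms_limitSeminorms (s : ℝ) (d : ℕ) : WithSeminorms (limitSeminorms s d) := ⟨rfl⟩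

instance (s : ℝ) (d : ℕ) : IsTopologicalAddGroup (GelfandShilov s d) :=
  (withSeminorms_limitSeminorms s d).topologicalAddGroup

instance (s : ℝ) (d : ℕ) : ContinuousSMul ℂ (GelfandShilov s d) :=
  (withSeminorms_limitSeminorms s d).continuousSMul

/-- The Gelfand–Shilov distribution space `𝒮_s'(ℝ^d)`: the strong dual of `𝒮_s(ℝ^d)`, i.e. the
continuous linear functionals with the topology of uniform convergence on bounded sets. -/
abbrev GelfandShilovDual (s : ℝ) (d : ℕ) : Type := StrongDual ℂ (GelfandShilov s d)

/-! ### Hermite functions -/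

/-- The function `e^{-|x|²}`. -/
noncomputable def gaussian {d : ℕ} (x : Fin d → ℝ) : ℂ := Complex.exp (-∑ j, (x j : ℂ) ^ 2)

/-- The Hermite function
`h_α(x) = π^{-d/4} (-1)^{|α|} (2^{|α|} α!)^{-1/2} e^{|x|²/2} ∂^α e^{-|x|²}`. -/
noncomputable def hermiteFun {d : ℕ} (α : MultiIndex d) (x : Fin d → ℝ) : ℂ :=
  ((Real.pi ^ (-(d : ℝ) / 4) * (-1) ^ α.degree *
      ((2 : ℝ) ^ α.degree * (mfact α : ℝ)) ^ (-(1 / 2 : ℝ)) : ℝ) : ℂ) *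
    Complex.exp ((∑ j, (x j : ℂ) ^ 2) / 2) * iteratedPartial α gaussian x

/-! The following helper facts show that `h_α` lies in `𝒮_{1/2}(ℝ^d)`. -/

/-- Complex derivatives of the one-dimensional Gaussian. -/
noncomputable def gaussDeriv (n : ℕ) : ℂ → ℂ := iteratedDeriv n fun z => Complex.exp (-z ^ 2)

theorem differentiable_gaussDeriv (n : ℕ) : Differentiable ℂ (gaussDeriv n) := by
  have h : Differentiable ℂ fun z : ℂ => Complex.exp (-z ^ 2) := by fun_prop
  exact (h.contDiff (n := ω)).differentiable_iteratedDeriv n (by simp)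

theorem hasDerivAt_gaussDeriv (n : ℕ) (z : ℂ) :
    HasDerivAt (gaussDeriv n) (gaussDeriv (n + 1) z) z := by
  have := (differentiable_gaussDeriv n z).hasDerivAt
  rwa [show deriv (gaussDeriv n) z = gaussDeriv (n + 1) z by
    simp only [gaussDeriv, iteratedDeriv_succ]] at this

theorem gaussDeriv_rec (n : ℕ) (z : ℂ) :
    gaussDeriv (n + 1) z = -2 * z * gaussDeriv n z - 2 * n * gaussDeriv (n - 1) z := by
  induction n generalizing z with
  | zero =>
    have h1 : HasDerivAt (fun z : ℂ => Complex.exp (-z ^ 2))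
        (Complex.exp (-z ^ 2) * (-(2 * z))) z := by
      simpa using ((hasDerivAt_pow 2 z).neg).cexp
    have h2 := (hasDerivAt_gaussDeriv 0 z)
    have h3 : gaussDeriv 0 = fun z : ℂ => Complex.exp (-z ^ 2) := by simp [gaussDeriv]
    rw [h3] at h2
    rw [h2.unique h1, h3]
    simp
    ring
  | succ n ih =>
    have h2 := hasDerivAt_gaussDeriv (n + 1) z
    have h1 : HasDerivAt (gaussDeriv (n + 1))
        (-2 * gaussDeriv n z + -2 * z * gaussDeriv (n + 1) z - 2 * n * gaussDeriv n z) z := by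
      have e1 : HasDerivAt (fun z : ℂ => -2 * z) (-2) z := by
        simpa using (hasDerivAt_id z).const_mul (-2 : ℂ)
      have e2 : HasDerivAt (fun z => 2 * (n : ℂ) * gaussDeriv (n - 1) z)
          (2 * n * gaussDeriv n z) z := by
        rcases n with _ | n
        · simpa using hasDerivAt_const z (0 : ℂ)
        · exact (hasDerivAt_gaussDeriv n z).const_mul _
      have e3 := (e1.mul (hasDerivAt_gaussDeriv n z)).sub e2
      refine e3.congr_of_eventuallyEq (Filter.Eventually.of_forall fun w => ?_)
      rw [ih w]
      rfl
    rw [h2.unique h1]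
    push_cast
    ring

/-- The unnormalised one-dimensional Hermite functions. -/
noncomputable def psi (n : ℕ) (t : ℝ) : ℂ :=
  (-1) ^ n * Complex.exp ((t : ℂ) ^ 2 / 2) * gaussDeriv n t

theorem mul_psi (n : ℕ) (t : ℝ) : (t : ℂ) * psi n t = psi (n + 1) t / 2 + n * psi (n - 1) t := by
  have h := gaussDeriv_rec n t
  rcases n with _ | n
  · simp only [psi, h]
    simp
    ring
  · simp only [psi, h, Nat.add_sub_cancel, pow_succ]
    push_cast
    ring

theorem hasDerivAt_psi (n : ℕ) (t : ℝ) :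
    HasDerivAt (psi n) (n * psi (n - 1) t - psi (n + 1) t / 2) t := by
  have e0 : HasDerivAt (fun z : ℂ => z ^ 2 / 2) (t : ℂ) (t : ℂ) := by
    simpa using (hasDerivAt_pow 2 (t : ℂ)).div_const 2
  have e1 : HasDerivAt (fun z : ℂ => (-1) ^ n * Complex.exp (z ^ 2 / 2) * gaussDeriv n z)
      ((-1) ^ n * (Complex.exp ((t : ℂ) ^ 2 / 2) * t) * gaussDeriv n t +
        (-1) ^ n * Complex.exp ((t : ℂ) ^ 2 / 2) * gaussDeriv (n + 1) t) (t : ℂ) :=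
    (e0.cexp.const_mul _).mul (hasDerivAt_gaussDeriv n t)
  have e2 := e1.comp_ofReal
  have h := mul_psi n t
  have h3 : (n : ℂ) * psi (n - 1) t = t * psi n t - psi (n + 1) t / 2 := by rw [h]; ring
  rw [h3]
  refine e2.congr_deriv ?_
  simp only [psi, pow_succ]
  ring

theorem contDiff_psi (n : ℕ) : ContDiff ℝ ∞ (psi n) := by
  have h : Differentiable ℂ fun z : ℂ => (-1) ^ n * Complex.exp (z ^ 2 / 2) * gaussDeriv n z :=
    (by fun_prop : Differentiable ℂ fun z : ℂ => (-1) ^ n * Complex.exp (z ^ 2 / 2)).mul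
      (differentiable_gaussDeriv n)
  exact ((h.contDiff (n := ∞)).restrict_scalars ℝ).comp Complex.ofRealCLM.contDiff

theorem norm_psi_le (n : ℕ) (t : ℝ) : ‖psi n t‖ ≤ 3 * 3 ^ n * √(n ! : ℝ) := by
  set R : ℝ := √(n + 1) with hR
  have hR0 : 0 < R := Real.sqrt_pos.2 (by positivity)
  have hR2 : R ^ 2 = n + 1 := Real.sq_sqrt (by positivity)
  have hd : Differentiable ℂ fun z : ℂ => Complex.exp (-z ^ 2) := by fun_prop
  have hC := Complex.norm_iteratedDeriv_le_of_forall_mem_sphere_norm_le (c := (t : ℂ))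
    (C := Real.exp (R ^ 2 - t ^ 2 / 2)) (f := fun z : ℂ => Complex.exp (-z ^ 2)) n hR0
    hd.diffContOnCl (by
      intro z hz
      have hz2 : (z.re - t) ^ 2 + z.im ^ 2 = R ^ 2 := by
        have : ‖z - t‖ = R := by simpa [dist_eq_norm] using hz
        rw [← this, ← Complex.normSq_eq_norm_sq, Complex.normSq_apply]
        simp
        ring
      rw [Complex.norm_exp]
      refine Real.exp_le_exp.2 ?_
      have : (-z ^ 2).re = z.im ^ 2 - z.re ^ 2 := by simp [pow_two]
      rw [this, ← hz2]
      nlinarith [sq_nonneg (2 * z.re - t)])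
  have h1 : ‖psi n t‖ = Real.exp (t ^ 2 / 2) * ‖gaussDeriv n t‖ := by
    have : ‖Complex.exp ((t : ℂ) ^ 2 / 2)‖ = Real.exp (t ^ 2 / 2) := by
      rw [show ((t : ℂ) ^ 2 / 2) = ((t ^ 2 / 2 : ℝ) : ℂ) by push_cast; rfl, Complex.norm_exp,
        Complex.ofReal_re]
    simp [psi, this]
  have h2 : Real.exp (t ^ 2 / 2) * Real.exp (R ^ 2 - t ^ 2 / 2) = Real.exp (n + 1) := by
    rw [← Real.exp_add, hR2]; congr 1; ring
  have h3 : Real.exp (n + 1) ≤ 3 * 3 ^ n := by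
    have : Real.exp ((n : ℝ) + 1) = Real.exp 1 ^ (n + 1) := by
      rw [← Real.exp_nat_mul]; push_cast; simp
    rw [this, ← pow_succ']
    exact pow_le_pow_left₀ (Real.exp_pos _).le (by linarith [Real.exp_one_lt_d9]) _
  have h4 : (n ! : ℝ) / R ^ n ≤ √(n ! : ℝ) := by
    rw [div_le_iff₀ (by positivity)]
    have h5 : √(n ! : ℝ) ≤ R ^ n := by
      refine Real.sqrt_le_iff.2 ⟨by positivity, ?_⟩
      rw [← pow_mul, mul_comm, pow_mul, hR2]
      have h6 : n ! ≤ (n + 1) ^ n :=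
        (Nat.factorial_le_pow n).trans (Nat.pow_le_pow_left (Nat.le_succ n) n)
      exact_mod_cast h6
    calc (n ! : ℝ) = √(n ! : ℝ) * √(n ! : ℝ) := (Real.mul_self_sqrt (by positivity)).symm
      _ ≤ _ := by gcongr
  rw [h1]
  calc Real.exp (t ^ 2 / 2) * ‖gaussDeriv n t‖
      ≤ Real.exp (t ^ 2 / 2) * ((n ! : ℝ) * Real.exp (R ^ 2 - t ^ 2 / 2) / R ^ n) := by
        gcongr
        exact hC
    _ = Real.exp (n + 1) * ((n ! : ℝ) / R ^ n) := by rw [← h2]; ring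
    _ ≤ _ := by gcongr

/-- The derivatives of `psi n`, written out by means of the ladder relations. -/
noncomputable def psiD (n : ℕ) : ℕ → ℝ → ℂ
  | 0 => psi n
  | a + 1 => fun t => n * psiD (n - 1) a t - psiD (n + 1) a t / 2
termination_by a => a

theorem hasDerivAt_psiD (n a : ℕ) (t : ℝ) : HasDerivAt (psiD n a) (psiD n (a + 1) t) t := by
  induction a generalizing n with
  | zero =>
    rw [show psiD n 0 = psi n by simp only [psiD]]
    rw [show psiD n (0 + 1) t = n * psi (n - 1) t - psi (n + 1) t / 2 by simp only [psiD]]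
    exact hasDerivAt_psi n t
  | succ a ih =>
    rw [show psiD n (a + 1) = fun t => n * psiD (n - 1) a t - psiD (n + 1) a t / 2 by
      simp only [psiD]]
    rw [show psiD n (a + 1 + 1) t = n * psiD (n - 1) (a + 1) t - psiD (n + 1) (a + 1) t / 2 by
      rw [psiD]]
    exact ((ih (n - 1)).const_mul _).sub ((ih (n + 1)).div_const 2)

theorem psiD_weight {n m : ℕ} (h : n ≤ m) :
    (n : ℝ) * (3 * 3 ^ (m - 1) * √((m - 1)! : ℝ)) ≤ 3 * 3 ^ (m + 1) * √((m + 1)! : ℝ) / 2 := by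
  rcases m with _ | m
  · have : n = 0 := by omega
    subst this
    simp only [Nat.cast_zero, zero_mul]
    positivity
  · simp only [Nat.add_sub_cancel]
    have h1 : (m + 1 : ℝ) * √(m ! : ℝ) ≤ √((m + 1 + 1)! : ℝ) := by
      refine Real.le_sqrt_of_sq_le ?_
      rw [mul_pow, Real.sq_sqrt (by positivity), Nat.factorial_succ, Nat.factorial_succ]
      push_cast
      have : (0 : ℝ) < m ! := by positivity
      nlinarith
    have h2 : (n : ℝ) ≤ m + 1 := by exact_mod_cast h
    calc (n : ℝ) * (3 * 3 ^ m * √(m ! : ℝ)) ≤ (m + 1) * (3 * 3 ^ m * √(m ! : ℝ)) := by gcongr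
      _ = 3 * 3 ^ m * ((m + 1) * √(m ! : ℝ)) := by ring
      _ ≤ 3 * 3 ^ m * √((m + 1 + 1)! : ℝ) := by gcongr
      _ ≤ _ := by
        have : (0 : ℝ) ≤ 3 ^ m * √((m + 1 + 1)! : ℝ) := by positivity
        rw [pow_succ, pow_succ]
        linarith

theorem norm_psiD_step {n N : ℕ} {u v : ℂ}
    (hu : ‖u‖ ≤ 3 * 3 ^ (n - 1 + N) * √((n - 1 + N)! : ℝ))
    (hv : ‖v‖ ≤ 3 * 3 ^ (n + 1 + N) * √((n + 1 + N)! : ℝ)) :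
    ‖(n : ℂ) * u‖ + ‖v / 2‖ ≤ 3 * 3 ^ (n + (N + 1)) * √((n + (N + 1))! : ℝ) := by
  have h2 : ‖v / 2‖ ≤ 3 * 3 ^ (n + (N + 1)) * √((n + (N + 1))! : ℝ) / 2 := by
    rw [norm_div, show ‖(2 : ℂ)‖ = 2 by simp, show n + (N + 1) = n + 1 + N by ring]
    gcongr
  have h1 : ‖(n : ℂ) * u‖ ≤ 3 * 3 ^ (n + (N + 1)) * √((n + (N + 1))! : ℝ) / 2 := by
    rw [norm_mul, Complex.norm_natCast]
    rcases n with _ | n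
    · simp only [Nat.cast_zero, zero_mul]
      positivity
    · have := psiD_weight (n := n + 1) (m := n + 1 + N) (by omega)
      rw [show n + 1 + N - 1 = n + 1 - 1 + N by omega,
        show n + 1 + N + 1 = n + 1 + (N + 1) by ring] at this
      exact le_trans (by gcongr) this
  linarith

theorem norm_pow_mul_psi_le (n b : ℕ) (t : ℝ) :
    ‖(t : ℂ) ^ b * psi n t‖ ≤ 3 * 3 ^ (n + b) * √((n + b)! : ℝ) := by
  induction b generalizing n with
  | zero => simpa using norm_psi_le n t
  | succ b ih =>
    rw [pow_succ, mul_assoc, mul_psi,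
      show (t : ℂ) ^ b * (psi (n + 1) t / 2 + n * psi (n - 1) t) =
        n * (t ^ b * psi (n - 1) t) + (t ^ b * psi (n + 1) t) / 2 by ring]
    exact (norm_add_le _ _).trans (norm_psiD_step (ih _) (ih _))

theorem norm_pow_mul_psiD_le (n a b : ℕ) (t : ℝ) :
    ‖(t : ℂ) ^ b * psiD n a t‖ ≤ 3 * 3 ^ (n + (a + b)) * √((n + (a + b))! : ℝ) := by
  induction a generalizing n with
  | zero =>
    rw [show psiD n 0 = psi n by simp only [psiD], Nat.zero_add]
    exact norm_pow_mul_psi_le n b t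
  | succ a ih =>
    rw [show psiD n (a + 1) t = n * psiD (n - 1) a t - psiD (n + 1) a t / 2 by rw [psiD],
      show (t : ℂ) ^ b * (n * psiD (n - 1) a t - psiD (n + 1) a t / 2) =
        n * (t ^ b * psiD (n - 1) a t) - (t ^ b * psiD (n + 1) a t) / 2 by ring,
      show a + 1 + b = a + b + 1 by ring]
    exact (norm_sub_le _ _).trans (norm_psiD_step (ih _) (ih _))

theorem factorial_add_le (p q : ℕ) : (p + q)! ≤ 2 ^ (p + q) * (p ! * q !) := by
  rw [← Nat.add_choose_mul_factorial_mul_factorial p q, mul_assoc]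
  exact Nat.mul_le_mul_right _ (Nat.choose_le_two_pow _ _)

theorem norm_pow_mul_psiD_le' (n a b : ℕ) (t : ℝ) :
    ‖(t : ℂ) ^ b * psiD n a t‖ ≤
      (3 * 6 ^ n * √(n ! : ℝ)) * (6 ^ (a + b) * √((a ! : ℝ) * (b ! : ℝ))) := by
  refine (norm_pow_mul_psiD_le n a b t).trans ?_
  have h1 : (n + (a + b))! ≤ (2 ^ (n + (a + b))) ^ 2 * (n ! * (a ! * b !)) := by
    calc (n + (a + b))! ≤ 2 ^ (n + (a + b)) * (n ! * (a + b)!) := factorial_add_le _ _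
      _ ≤ 2 ^ (n + (a + b)) * (n ! * (2 ^ (a + b) * (a ! * b !))) := by
        gcongr; exact factorial_add_le _ _
      _ = 2 ^ (n + (a + b)) * 2 ^ (a + b) * (n ! * (a ! * b !)) := by ring
      _ ≤ 2 ^ (n + (a + b)) * 2 ^ (n + (a + b)) * (n ! * (a ! * b !)) :=
        Nat.mul_le_mul_right _ (Nat.mul_le_mul_left _
          (Nat.pow_le_pow_right (by norm_num) (Nat.le_add_left _ _)))
      _ = _ := by ring
  have h2 : √((n + (a + b))! : ℝ) ≤ 2 ^ (n + (a + b)) * (√(n ! : ℝ) * √((a ! : ℝ) * (b ! : ℝ))) := by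
    rw [← Real.sqrt_mul (by positivity)]
    refine Real.sqrt_le_iff.2 ⟨by positivity, ?_⟩
    rw [mul_pow, Real.sq_sqrt (by positivity)]
    exact_mod_cast h1
  calc 3 * 3 ^ (n + (a + b)) * √((n + (a + b))! : ℝ)
      ≤ 3 * 3 ^ (n + (a + b)) *
        (2 ^ (n + (a + b)) * (√(n ! : ℝ) * √((a ! : ℝ) * (b ! : ℝ)))) := by gcongr
    _ = _ := by
      rw [show (6 : ℝ) = 3 * 2 by norm_num, mul_pow, mul_pow, pow_add 3 n, pow_add 2 n]
      ring

theorem partialDeriv_prod {d : ℕ} {F : Fin d → ℕ → ℝ → ℂ}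
    (hF : ∀ j n t, HasDerivAt (F j n) (F j (n + 1) t) t) (m : Fin d → ℕ) (j : Fin d) :
    partialDeriv j (fun x => ∏ k, F k (m k) (x k)) =
      fun x => ∏ k, F k (Function.update m j (m j + 1) k) (x k) := by
  funext x
  rw [partialDeriv, lineDeriv]
  have h1 : (fun t : ℝ => ∏ k, F k (m k) ((x + t • (Pi.single j 1 : Fin d → ℝ)) k)) =
      fun t : ℝ => F j (m j) (x j + t) * ∏ k ∈ Finset.univ.erase j, F k (m k) (x k) := by
    funext t
    rw [← Finset.mul_prod_erase _ _ (Finset.mem_univ j)]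
    congr 1
    · simp
    · refine Finset.prod_congr rfl fun k hk => ?_
      have : k ≠ j := Finset.ne_of_mem_erase hk
      simp [this]
  rw [h1, ← Finset.mul_prod_erase _ _ (Finset.mem_univ j)]
  have h2 : HasDerivAt (fun t : ℝ => F j (m j) (x j + t)) (F j (m j + 1) (x j)) 0 := by
    have := (hF j (m j) (x j + 0)).comp_const_add (x j) 0
    simpa using this
  rw [(h2.mul_const _).deriv]
  congr 1
  · simp
  · refine Finset.prod_congr rfl fun k hk => ?_
    simp [Function.update_of_ne (Finset.ne_of_mem_erase hk)]

theorem iterate_partialDeriv_prod {d : ℕ} {F : Fin d → ℕ → ℝ → ℂ}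
    (hF : ∀ j n t, HasDerivAt (F j n) (F j (n + 1) t) t) (m : Fin d → ℕ) (j : Fin d) (n : ℕ) :
    (partialDeriv j)^[n] (fun x => ∏ k, F k (m k) (x k)) =
      fun x => ∏ k, F k (Function.update m j (m j + n) k) (x k) := by
  induction n with
  | zero => simp
  | succ n ih =>
    rw [Function.iterate_succ_apply', ih, partialDeriv_prod hF]
    simp [add_assoc]

theorem iteratedPartial_prod {d : ℕ} {F : Fin d → ℕ → ℝ → ℂ}
    (hF : ∀ j n t, HasDerivAt (F j n) (F j (n + 1) t) t) (α : MultiIndex d) :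
    iteratedPartial α (fun x => ∏ k, F k 0 (x k)) = fun x => ∏ k, F k (α k) (x k) := by
  have key : ∀ l : List (Fin d), l.Nodup →
      l.foldr (fun j g => (partialDeriv j)^[α j] g) (fun x => ∏ k, F k 0 (x k)) =
        fun x => ∏ k, F k (if k ∈ l then α k else 0) (x k) := by
    intro l hl
    induction l with
    | nil => simp
    | cons j l ih =>
      rw [List.nodup_cons] at hl
      rw [List.foldr_cons, ih hl.2,
        iterate_partialDeriv_prod hF (fun k => if k ∈ l then α k else 0)]
      funext x
      refine Finset.prod_congr rfl fun k _ => ?_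
      congr 1
      by_cases hk : k = j
      · subst hk
        simp [hl.1]
      · simp [hk]
  rw [iteratedPartial, key _ (List.nodup_finRange d)]
  simp

/-- The normalising constant relating `h_α` and the product of the `psi (α j)`. -/
noncomputable def hermiteConst {d : ℕ} (α : MultiIndex d) : ℂ :=
  ((Real.pi ^ (-(d : ℝ) / 4) * ((2 : ℝ) ^ α.degree * (mfact α : ℝ)) ^ (-(1 / 2 : ℝ)) : ℝ) : ℂ)

theorem hermiteFun_eq {d : ℕ} (α : MultiIndex d) :
    hermiteFun α = hermiteConst α • fun x => ∏ j, psi (α j) (x j) := by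
  have hF : ∀ (_ : Fin d) (n : ℕ) (t : ℝ), HasDerivAt (fun t : ℝ => gaussDeriv n t)
      (gaussDeriv (n + 1) t) t := fun _ n t => (hasDerivAt_gaussDeriv n t).comp_ofReal
  have h0 : (gaussian : (Fin d → ℝ) → ℂ) = fun x => ∏ j, gaussDeriv 0 (x j : ℂ) := by
    funext x
    simp [gaussian, gaussDeriv, ← Complex.exp_sum]
  have h1 : iteratedPartial α gaussian = fun x => ∏ j, gaussDeriv (α j) (x j : ℂ) := by
    rw [h0]
    exact iteratedPartial_prod (F := fun _ n t => gaussDeriv n (t : ℂ)) hF α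
  funext x
  rw [hermiteFun, h1, Pi.smul_apply, smul_eq_mul]
  simp only [psi, Finset.prod_mul_distrib, Finset.prod_pow_eq_pow_sum, ← Complex.exp_sum,
    ← Finset.sum_div, hermiteConst]
  rw [show ∑ i, α i = α.degree from (Finsupp.degree_eq_sum α).symm]
  push_cast
  ring

theorem contDiff_prod_psi {d : ℕ} (α : MultiIndex d) :
    ContDiff ℝ ∞ fun x : Fin d → ℝ => ∏ j, psi (α j) (x j) :=
  contDiff_prod fun j _ => (contDiff_psi (α j)).comp (contDiff_apply ℝ ℝ j)

theorem hermiteFun_mem {d : ℕ} (γ : MultiIndex d) : hermiteFun γ ∈ gsSubmodule (1 / 2) d := by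
  rw [hermiteFun_eq]
  refine Submodule.smul_mem _ _ ⟨contDiff_prod_psi γ, 6, by norm_num, ?_⟩
  refine lt_of_le_of_lt (b := ENNReal.ofReal (∏ j, (3 * 6 ^ (γ j) * √((γ j)! : ℝ)))) ?_
    ENNReal.ofReal_lt_top
  rw [gsNorm_le_iff]
  intro α β x
  refine ENNReal.ofReal_le_ofReal ?_
  have hm : (0 : ℝ) < ((mfact α : ℝ) * (mfact β : ℝ)) ^ (1 / 2 : ℝ) :=
    Real.rpow_pos_of_pos (mul_pos (mfact_pos α) (mfact_pos β)) _
  rw [div_le_iff₀ (by positivity)]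
  have h0 : (fun x : Fin d → ℝ => ∏ j, psi (γ j) (x j)) =
      fun x => ∏ j, psiD (γ j) 0 (x j) := by
    simp only [psiD]
  rw [h0, iteratedPartial_prod (F := fun j n => psiD (γ j) n)
    (fun j n t => hasDerivAt_psiD (γ j) n t) α]
  have h1 : (monom β x : ℂ) * ∏ j, psiD (γ j) (α j) (x j) =
      ∏ j, ((x j : ℂ) ^ β j * psiD (γ j) (α j) (x j)) := by
    rw [Finset.prod_mul_distrib, monom]
    push_cast
    rfl
  rw [h1, norm_prod]
  refine (Finset.prod_le_prod (fun _ _ => norm_nonneg _)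
    (fun j _ => norm_pow_mul_psiD_le' (γ j) (α j) (β j) (x j))).trans (le_of_eq ?_)
  rw [Finset.prod_mul_distrib]
  congr 1
  rw [Finset.prod_mul_distrib, Finset.prod_pow_eq_pow_sum, Finset.sum_add_distrib,
    ← Finsupp.degree_eq_sum, ← Finsupp.degree_eq_sum, ← Real.sqrt_eq_rpow,
    ← Real.sqrt_prod _ (fun _ _ => by positivity), Finset.prod_mul_distrib]
  simp [mfact]

/-- The Hermite function `h_α` as an element of `𝒮_{1/2}(ℝ^d)`. -/
noncomputable def hermiteGS {d : ℕ} (α : MultiIndex d) : GelfandShilov (1 / 2) d :=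
  (⟨hermiteFun α, hermiteFun_mem α⟩ : ↥(gsSubmodule (1 / 2) d))

/-! ### Formal Hermite series -/

/-- The space `ℋ_0'(ℝ^d)` of all formal Hermite series `∑_α c(α) h_α`, represented by their
coefficient sequences `c`. -/
abbrev HermiteSeries (d : ℕ) : Type := MultiIndex d → ℂ

/-- The Hermite series of `f ∈ 𝒮_{1/2}(ℝ^d)`, with coefficients
`c_h(f, α) = (f, h_α)_{L²} = ∫ f(x) \overline{h_α(x)} dx`. -/
noncomputable def GelfandShilov.series {d : ℕ} (f : GelfandShilov (1 / 2) d) : HermiteSeries d :=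
  fun α => ∫ x, f.toFun x * starRingEnd ℂ (hermiteFun α x)

/-- The Hermite series of `u ∈ 𝒮_{1/2}'(ℝ^d)`, with coefficients `u(h_α)` (recall that `h_α` is
real valued). -/
noncomputable def dualSeries {d : ℕ} (u : GelfandShilovDual (1 / 2) d) : HermiteSeries d :=
  fun α => u (hermiteGS α)

/-- `𝒮_{1/2}(ℝ^d)` as a subset of `ℋ_0'(ℝ^d)`. -/
def gsSet (d : ℕ) : Set (HermiteSeries d) :=
  Set.range (GelfandShilov.series : GelfandShilov (1 / 2) d → HermiteSeries d)

/-- `𝒮_{1/2}'(ℝ^d)` as a subset of `ℋ_0'(ℝ^d)`. -/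
def gsDualSet (d : ℕ) : Set (HermiteSeries d) :=
  Set.range (dualSeries : GelfandShilovDual (1 / 2) d → HermiteSeries d)

/-- The Pilipović distribution space `ℋ_{0,s}'(ℝ^d)` of Beurling type, `s > 0` real: the formal
Hermite series with `|c(α)| ≤ C e^{r |α|^{1/(2s)}}` for some `r > 0` and some `C`. -/
def pilipovicBeurlingDual (s : ℝ) (d : ℕ) : Set (HermiteSeries d) :=
  {c | ∃ r : ℝ, 0 < r ∧ ∃ C : ℝ, ∀ α : MultiIndex d,
    ‖c α‖ ≤ C * Real.exp (r * (α.degree : ℝ) ^ (1 / (2 * s)))}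

/-! ### Fractional Fourier transforms and harmonic oscillator propagators -/

/-- The Bargmann transform `∑_α c(α) h_α ↦ ∑_α c(α) z^α / √(α!)` from formal Hermite series to
formal power series. -/
noncomputable def bargmann (d : ℕ) : HermiteSeries d ≃ MvPowerSeries (Fin d) ℂ where
  toFun c := fun α => c α / ((√(mfact α : ℝ) : ℝ) : ℂ)
  invFun F := fun α => ((√(mfact α : ℝ) : ℝ) : ℂ) * MvPowerSeries.coeff α F
  left_inv c := by
    funext α
    have : ((√(mfact α : ℝ) : ℝ) : ℂ) ≠ 0 := by
      exact_mod_cast (Real.sqrt_pos.2 (mfact_pos α)).ne'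
    change _ * (c α / _) = c α
    field_simp
  right_inv F := by
    funext α
    have : ((√(mfact α : ℝ) : ℝ) : ℂ) ≠ 0 := by
      exact_mod_cast (Real.sqrt_pos.2 (mfact_pos α)).ne'
    change _ * F α / _ = F α
    field_simp

/-- The fractional Fourier transform of multiple order `ϱ ∈ ℂ^d` on `ℋ_0'(ℝ^d)`: on the Bargmann
side it is `F(z) ↦ F(e^{-iπϱ₁/2} z₁, …, e^{-iπϱ_d/2} z_d)`. -/
noncomputable def fracFourier {d : ℕ} (ϱ : Fin d → ℂ) (c : HermiteSeries d) : HermiteSeries d :=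
  (bargmann d).symm
    (MvPowerSeries.rescale (fun j => Complex.exp (-(Complex.I * Real.pi * ϱ j / 2)))
      (bargmann d c))

/-- The generalized harmonic oscillator `H_{x,ϱ} = ∑_j ϱ_j (x_j² - ∂_j²)` on functions. -/
noncomputable def harmonicOscillator {d : ℕ} (ϱ : Fin d → ℂ) (f : (Fin d → ℝ) → ℂ)
    (x : Fin d → ℝ) : ℂ :=
  ∑ j, ϱ j * ((x j : ℂ) ^ 2 * f x - partialDeriv j (partialDeriv j f) x)

/-- The eigenvalue `2⟨α, ϱ⟩ + sum(ϱ)` of `H_{x,ϱ}` at `h_α`. -/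
def oscEigenvalue {d : ℕ} (ϱ : Fin d → ℂ) (α : MultiIndex d) : ℂ :=
  2 * ∑ j, (α j : ℂ) * ϱ j + ∑ j, ϱ j

theorem psiD_two (n : ℕ) (t : ℝ) :
    (t : ℂ) ^ 2 * psi n t - psiD n 2 t = (2 * n + 1) * psi n t := by
  have e : psiD n 2 t = n * ((n - 1 : ℕ) * psi (n - 1 - 1) t - psi (n - 1 + 1) t / 2) -
      ((n + 1 : ℕ) * psi (n + 1 - 1) t - psi (n + 1 + 1) t / 2) / 2 := by
    simp only [psiD]
  rw [e, pow_two, mul_assoc, mul_psi, mul_add, mul_left_comm, mul_psi (n - 1),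
    mul_div_assoc', mul_psi (n + 1)]
  rcases n with _ | n
  · simp
    ring
  · simp only [Nat.add_sub_cancel]
    push_cast
    ring

/-- `H_{x,ϱ} h_α = (2⟨α, ϱ⟩ + sum(ϱ)) h_α`. -/
theorem harmonicOscillator_hermiteFun {d : ℕ} (ϱ : Fin d → ℂ) (α : MultiIndex d) :
    harmonicOscillator ϱ (hermiteFun α) = oscEigenvalue ϱ α • hermiteFun α := by
  have h0 : (fun x : Fin d → ℝ => ∏ j, psi (α j) (x j)) =
      fun x => ∏ j, psiD (α j) 0 (x j) := by
    simp only [psiD]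
  have h1 : ∀ j, partialDeriv j (partialDeriv j (hermiteFun α)) = hermiteConst α •
      fun x => ∏ k, psiD (α k) (Function.update (fun _ => 0) j 2 k) (x k) := by
    intro j
    have hc := contDiff_prod_psi α
    rw [hermiteFun_eq, partialDeriv_smul j _ hc,
      partialDeriv_smul j _ (contDiff_partialDeriv j hc), h0]
    congr 1
    have := iterate_partialDeriv_prod (F := fun j n => psiD (α j) n)
      (fun j n t => hasDerivAt_psiD (α j) n t) (fun _ => 0) j 2
    simpa using this
  funext x
  have h2 : ∀ j, (x j : ℂ) ^ 2 * hermiteFun α x -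
      partialDeriv j (partialDeriv j (hermiteFun α)) x = (2 * α j + 1) * hermiteFun α x := by
    intro j
    rw [h1 j, hermiteFun_eq]
    simp only [Pi.smul_apply, smul_eq_mul]
    have h3 := psiD_two (α j) (x j)
    have h4 : ∏ k, psiD (α k) (Function.update (fun _ => 0) j 2 k) (x k) =
        psiD (α j) 2 (x j) * ∏ k ∈ Finset.univ.erase j, psi (α k) (x k) := by
      rw [← Finset.mul_prod_erase _ _ (Finset.mem_univ j)]
      congr 1
      · simp
      · refine Finset.prod_congr rfl fun k hk => ?_
        rw [Function.update_of_ne (Finset.ne_of_mem_erase hk)]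
        simp only [psiD]
    rw [h4, ← Finset.mul_prod_erase _ (fun k => psi (α k) (x k)) (Finset.mem_univ j)]
    linear_combination (hermiteConst α * ∏ k ∈ Finset.univ.erase j, psi (α k) (x k)) * h3
  simp only [harmonicOscillator, h2, oscEigenvalue, Pi.smul_apply, smul_eq_mul]
  rw [add_mul, Finset.mul_sum, Finset.sum_mul, Finset.sum_mul, ← Finset.sum_add_distrib]
  refine Finset.sum_congr rfl fun j _ => ?_
  ring

/-- The operator `e^{ζ H_{x,ϱ}}` on `ℋ_0'(ℝ^d)`, defined through the eigenfunctions `h_α` of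
`H_{x,ϱ}`: `∑_α c(α) h_α ↦ ∑_α e^{ζ (2⟨α, ϱ⟩ + sum(ϱ))} c(α) h_α`. -/
noncomputable def propagator {d : ℕ} (ζ : ℂ) (ϱ : Fin d → ℂ) (c : HermiteSeries d) :
    HermiteSeries d :=
  fun α => Complex.exp (ζ * oscEigenvalue ϱ α) * c α

/-! ### Continuity of operators on `ℋ_0'(ℝ^d)` between Gelfand–Shilov spaces -/

/-- `A` maps `𝒮_{1/2}'(ℝ^d)` continuously (and linearly) into `𝒮_{1/2}(ℝ^d)`. -/
def MapsDualContinuously {d : ℕ} (A : HermiteSeries d → HermiteSeries d) : Prop :=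
  ∃ T : GelfandShilovDual (1 / 2) d →L[ℂ] GelfandShilov (1 / 2) d,
    ∀ u, (T u).series = A (dualSeries u)

/-- `ℋ_0(ℝ^d)`: the finite linear combinations of Hermite functions. -/
noncomputable def finiteHermite (d : ℕ) : Submodule ℂ (GelfandShilov (1 / 2) d) :=
  Submodule.span ℂ (Set.range hermiteGS)

/-- `A` is discontinuous from `𝒮_{1/2}(ℝ^d)` to `𝒮_{1/2}'(ℝ^d)`: on no domain `D` with
`ℋ_0(ℝ^d) ⊆ D ⊆ 𝒮_{1/2}(ℝ^d)` does it act as a continuous map into `𝒮_{1/2}'(ℝ^d)`, where `D`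
carries the topology induced by `𝒮_{1/2}(ℝ^d)`. This includes `D = 𝒮_{1/2}(ℝ^d)`, the maximal
domain of all `f` with `A f ∈ 𝒮_{1/2}'(ℝ^d)`, and `D = ℋ_0(ℝ^d)`. -/
def IsDiscontinuousToDual {d : ℕ} (A : HermiteSeries d → HermiteSeries d) : Prop :=
  ∀ D : Set (GelfandShilov (1 / 2) d), (finiteHermite d : Set (GelfandShilov (1 / 2) d)) ⊆ D →
    ¬ ∃ T : GelfandShilov (1 / 2) d → GelfandShilovDual (1 / 2) d,
      ContinuousOn T D ∧ ∀ f ∈ D, dualSeries (T f) = A f.series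

end FracFourier

namespace FracFourier

/-! ### Growth of the one-dimensional Hermite functions -/

/-! Both operators are diagonal in the Hermite basis. On the Bargmann side $\mathscr F_\varrho$
rescales the variables, so it multiplies the coefficient of $h_\gamma$ by
$m(\gamma)=e^{-i\pi\langle\gamma,\varrho\rangle/2}$; the propagator uses $\kappa m$ with the nonzero
constant $\kappa=e^{-i\pi\sum_j\varrho_j/4}$. Since
$|m(\gamma)|=e^{\frac\pi2\sum_j\gamma_j\operatorname{Im}\varrho_j}$, everything is decided by
exponential rates of coefficients.

Three facts translate the spaces into such rates. Exponentially decaying coefficients define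
elements of $\mathcal S_{1/2}$, with norm control (`exists_gsNorm_hermiteSum_le`). Coefficients of
elements of $\mathcal S_{1/2}'$ are $O(e^{\delta|\gamma|})$ for every $\delta>0$
(`exists_norm_le_of_mem_gsDualSet`). Coefficients of elements of $\mathcal S_{1/2}$ are
$O(e^{|\gamma|})$ (`exists_norm_le_of_mem_gsSet`), a crude bound that suffices here. All three come
from `exists_norm_pow_mul_psiD_le`: for every $\delta>0$ the functions $e^{-\delta|\gamma|}h_\gamma$
are bounded in a single $\mathcal S_{1/2,H}$. Cauchy estimates with a nearly optimal radius and the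
ladder relations give it. Orthonormality identifies a convergent Hermite series with its
coefficients.

If all $\operatorname{Im}\varrho_j<0$, then $m$ decays exponentially and beats subexponential
growth, which gives a continuous map $\mathcal S_{1/2}'\to\mathcal S_{1/2}$. The sequence
$|m|^{1/2}$ is in $\mathcal S_{1/2}$, but dividing it by $m$ leaves exponential growth, so it is not
in the image. If all $\operatorname{Im}\varrho_j>0$, the inverse multiplier, that of $-\varrho$,
decays, so $\mathcal S_{1/2}'$ lies in the image of $\mathcal S_{1/2}$; and $m(\gamma)e^{2|\gamma|}$
is in $\mathcal H_{0,1/2}'$ but not in that image. One index with $\operatorname{Im}\varrho_j>0$ is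
enough for $m$ to grow along $ne_j$: a slowly decaying sequence is then moved out of $\mathcal
S_{1/2}'$, and a null sequence $e^{-\delta n}h_{ne_j}$ has images that are unbounded on a bounded
set (`isDiscontinuousToDual_of_exp_le`). -/

theorem factorial_mul_exp_le (n : ℕ) :
    (n ! : ℝ) * Real.exp n ≤ (n + 1) * (n + 1 : ℝ) ^ n := by
  induction n with
  | zero => simp
  | succ n ih =>
    -- The induction step amounts to $(1-\frac1{n+2})^{n+2}\le e^{-1}$.
    have h1 : ((n : ℝ) + 1) / (n + 2) ≤ Real.exp (-(1 / (n + 2))) := by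
      have := Real.add_one_le_exp (-(1 / ((n : ℝ) + 2)))
      refine le_trans (le_of_eq ?_) this
      field_simp
      ring
    have h2 : ((n : ℝ) + 1) ^ (n + 2) * Real.exp 1 ≤ (n + 2 : ℝ) ^ (n + 2) := by
      have h3 := pow_le_pow_left₀ (by positivity) h1 (n + 2)
      rw [← Real.exp_nat_mul, div_pow, div_le_iff₀ (by positivity)] at h3
      have h4 : ((n + 2 : ℕ) : ℝ) * -(1 / ((n : ℝ) + 2)) = -1 := by
        push_cast
        field_simp
      rw [h4, Real.exp_neg, inv_mul_eq_div, le_div_iff₀ (Real.exp_pos 1)] at h3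
      exact h3
    rw [Nat.factorial_succ]
    push_cast
    rw [Real.exp_add]
    calc ((n : ℝ) + 1) * n ! * (Real.exp n * Real.exp 1)
        = (n + 1) * ((n ! : ℝ) * Real.exp n) * Real.exp 1 := by ring
      _ ≤ (n + 1) * ((n + 1) * (n + 1 : ℝ) ^ n) * Real.exp 1 := by gcongr
      _ = ((n : ℝ) + 1) ^ (n + 2) * Real.exp 1 := by ring
      _ ≤ (n + 2 : ℝ) ^ (n + 2) := h2
      _ = _ := by ring

/-- Sharpens `norm_psi_le`, which loses an exponential factor against the normalisation $\sqrt{2^n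
n!}$. Only a power of $n$ may be lost here, because the rate $\delta$ must later be arbitrarily
small. -/
theorem norm_psi_le_sqrt (n : ℕ) (t : ℝ) :
    ‖psi n t‖ ≤ 2 * √((2 : ℝ) ^ n * n !) * √(n + 1 : ℝ) := by
  -- Cauchy's estimate gives $n!\,e^{R^2}R^{-n}$, which is smallest at $R^2=n/2$; replacing $n$ by
  -- $n+1$ keeps $R>0$ when $n=0$.
  set R : ℝ := √((n + 1) / 2) with hR
  have hR0 : 0 < R := Real.sqrt_pos.2 (by positivity)
  have hR2 : R ^ 2 = (n + 1) / 2 := Real.sq_sqrt (by positivity)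
  have hd : Differentiable ℂ fun z : ℂ => Complex.exp (-z ^ 2) := by fun_prop
  have hC := Complex.norm_iteratedDeriv_le_of_forall_mem_sphere_norm_le (c := (t : ℂ))
    (C := Real.exp (R ^ 2 - t ^ 2 / 2)) (f := fun z : ℂ => Complex.exp (-z ^ 2)) n hR0
    hd.diffContOnCl (by
      intro z hz
      have hz2 : (z.re - t) ^ 2 + z.im ^ 2 = R ^ 2 := by
        have : ‖z - t‖ = R := by simpa [dist_eq_norm] using hz
        rw [← this, ← Complex.normSq_eq_norm_sq, Complex.normSq_apply]
        simp
        ring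
      rw [Complex.norm_exp]
      refine Real.exp_le_exp.2 ?_
      have : (-z ^ 2).re = z.im ^ 2 - z.re ^ 2 := by simp [pow_two]
      rw [this, ← hz2]
      -- With $x=\operatorname{Re}z$, this is $(x-t)^2+x^2=\frac12((2x-t)^2+t^2)\ge\frac12t^2$.
      nlinarith [sq_nonneg (2 * z.re - t)])
  have h1 : ‖psi n t‖ = Real.exp (t ^ 2 / 2) * ‖gaussDeriv n t‖ := by
    have : ‖Complex.exp ((t : ℂ) ^ 2 / 2)‖ = Real.exp (t ^ 2 / 2) := by
      rw [show ((t : ℂ) ^ 2 / 2) = ((t ^ 2 / 2 : ℝ) : ℂ) by push_cast; rfl, Complex.norm_exp,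
        Complex.ofReal_re]
    simp [psi, this]
  have h2 : ‖psi n t‖ ≤ n ! * Real.exp (R ^ 2) / R ^ n := by
    rw [h1]
    refine (mul_le_mul_of_nonneg_left hC (Real.exp_pos _).le).trans (le_of_eq ?_)
    rw [Real.exp_sub]
    field_simp
  rw [mul_assoc, ← Real.sqrt_mul (by positivity)]
  refine h2.trans ?_
  rw [show (2 : ℝ) = √4 by rw [show (4 : ℝ) = 2 ^ 2 by norm_num]; simp,
    ← Real.sqrt_mul (by positivity)]
  refine Real.le_sqrt_of_sq_le ?_
  rw [show √(4 : ℝ) = 2 by rw [show (4 : ℝ) = 2 ^ 2 by norm_num]; simp]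
  have h3 : (R ^ n) ^ 2 = ((n : ℝ) + 1) ^ n / 2 ^ n := by
    rw [← pow_mul, mul_comm, pow_mul, hR2, div_pow]
  have h4 : Real.exp (R ^ 2) ^ 2 = Real.exp n * Real.exp 1 := by
    rw [← Real.exp_nat_mul, hR2, ← Real.exp_add]
    congr 1
    push_cast
    ring
  rw [div_pow, mul_pow, h3, h4, div_le_iff₀ (by positivity)]
  have h5 := factorial_mul_exp_le n
  have h6 : Real.exp 1 ≤ 4 := by linarith [Real.exp_one_lt_d9]
  calc (n ! : ℝ) ^ 2 * (Real.exp n * Real.exp 1)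
      = n ! * ((n ! : ℝ) * Real.exp n) * Real.exp 1 := by ring
    _ ≤ n ! * ((n + 1) * (n + 1 : ℝ) ^ n) * 4 := by gcongr
    _ = _ := by field_simp

/-- Multiplication by $t$ and differentiation both turn $\psi_n$ into $n\psi_{n-1}$ and
$\frac12\psi_{n+1}$, up to sign. Relative to $\sqrt{2^n n!}$ these terms cost $\sqrt{n/2}$ and
$\sqrt{(n+1)/2}$, both at most $\sqrt{n+N+2}$. One bound thus drives both inductions that follow. -/
theorem ladder_bound (n N : ℕ) {u v : ℂ}
    (hu : ‖u‖ ≤ 2 * √((2 : ℝ) ^ (n - 1) * (n - 1)!) * 2 ^ N * √((n - 1 : ℕ) + N + 1 : ℝ) ^ (N + 1))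
    (hv : ‖v‖ ≤ 2 * √((2 : ℝ) ^ (n + 1) * (n + 1)!) * 2 ^ N * √((n + 1 : ℕ) + N + 1 : ℝ) ^ (N + 1)) :
    ‖(n : ℂ) * u‖ + ‖v / 2‖ ≤
      2 * √((2 : ℝ) ^ n * n !) * 2 ^ (N + 1) * √(n + (N + 1 : ℕ) + 1 : ℝ) ^ (N + 1 + 1) := by
  set S : ℝ := √(n + (N + 1 : ℕ) + 1 : ℝ) with hS
  have hS0 : 0 ≤ S := Real.sqrt_nonneg _
  set W : ℝ := √((2 : ℝ) ^ n * n !) with hW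
  have hu' : ‖(n : ℂ) * u‖ ≤ W * S * (2 * 2 ^ N * S ^ (N + 1)) := by
    rw [norm_mul, Complex.norm_natCast]
    rcases n with _ | n
    · simp only [Nat.cast_zero, zero_mul]
      positivity
    · simp only [Nat.add_sub_cancel] at hu
      have e1 : √((n : ℝ) + N + 1) ≤ S := by
        rw [hS]
        apply Real.sqrt_le_sqrt
        push_cast
        linarith
      have e2 : ((n + 1 : ℕ) : ℝ) * √((2 : ℝ) ^ n * n !) ≤ W * S := by
        rw [hW, hS, ← Real.sqrt_mul (by positivity)]
        refine Real.le_sqrt_of_sq_le ?_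
        rw [mul_pow, Real.sq_sqrt (by positivity), Nat.factorial_succ, pow_succ (2 : ℝ) n]
        push_cast
        have : (0 : ℝ) ≤ 2 ^ n * n ! * (n + 1) := by positivity
        have h0 : (0:ℝ) ≤ n := by positivity
        have h1 : (0:ℝ) ≤ N := by positivity
        nlinarith [mul_nonneg this h0, mul_nonneg this h1]
      calc ((n + 1 : ℕ) : ℝ) * ‖u‖
          ≤ ((n + 1 : ℕ) : ℝ) * (2 * √((2 : ℝ) ^ n * n !) * 2 ^ N * S ^ (N + 1)) := by
            refine mul_le_mul_of_nonneg_left (hu.trans ?_) (by positivity)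
            gcongr
        _ = (((n + 1 : ℕ) : ℝ) * √((2 : ℝ) ^ n * n !)) * (2 * 2 ^ N * S ^ (N + 1)) := by ring
        _ ≤ _ := by gcongr
  have hv' : ‖v / 2‖ ≤ W * S * (2 * 2 ^ N * S ^ (N + 1)) := by
    rw [norm_div, show ‖(2 : ℂ)‖ = 2 by simp]
    have e1 : √(((n + 1 : ℕ) : ℝ) + N + 1) = S := by
      rw [hS]
      congr 1
      push_cast
      ring
    have e2 : √((2 : ℝ) ^ (n + 1) * (n + 1)!) / 2 ≤ W * S := by
      rw [div_le_iff₀ (by norm_num), hW, hS, ← Real.sqrt_mul (by positivity)]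
      refine Real.sqrt_le_iff.2 ⟨by positivity, ?_⟩
      rw [mul_pow, Real.sq_sqrt (by positivity), Nat.factorial_succ, pow_succ (2 : ℝ) n]
      push_cast
      have : (0 : ℝ) ≤ 2 ^ n * n ! := by positivity
      have h0 : (0:ℝ) ≤ n := by positivity
      have h1 : (0:ℝ) ≤ N := by positivity
      nlinarith [mul_nonneg this h0, mul_nonneg this h1]
    rw [e1] at hv
    calc ‖v‖ / 2 ≤ (2 * √((2 : ℝ) ^ (n + 1) * (n + 1)!) * 2 ^ N * S ^ (N + 1)) / 2 := by gcongr
      _ = (√((2 : ℝ) ^ (n + 1) * (n + 1)!) / 2) * (2 * 2 ^ N * S ^ (N + 1)) := by ring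
      _ ≤ _ := by gcongr
  calc _ ≤ _ := add_le_add hu' hv'
    _ = _ := by ring

theorem norm_pow_mul_psi_le_sqrt (n b : ℕ) (t : ℝ) :
    ‖(t : ℂ) ^ b * psi n t‖ ≤ 2 * √((2 : ℝ) ^ n * n !) * 2 ^ b * √(n + b + 1 : ℝ) ^ (b + 1) := by
  induction b generalizing n with
  | zero => simpa using norm_psi_le_sqrt n t
  | succ b ih =>
    rw [pow_succ, mul_assoc, mul_psi,
      show (t : ℂ) ^ b * (psi (n + 1) t / 2 + n * psi (n - 1) t) =
        n * (t ^ b * psi (n - 1) t) + (t ^ b * psi (n + 1) t) / 2 by ring]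
    exact (norm_add_le _ _).trans (ladder_bound n b (ih _) (ih _))

theorem norm_pow_mul_psiD_le_sqrt (n a b : ℕ) (t : ℝ) :
    ‖(t : ℂ) ^ b * psiD n a t‖ ≤
      2 * √((2 : ℝ) ^ n * n !) * 2 ^ (a + b) * √(n + (a + b : ℕ) + 1 : ℝ) ^ (a + b + 1) := by
  induction a generalizing n with
  | zero =>
    rw [show psiD n 0 = psi n by simp only [psiD], Nat.zero_add]
    exact norm_pow_mul_psi_le_sqrt n b t
  | succ a ih =>
    rw [show psiD n (a + 1) t = n * psiD (n - 1) a t - psiD (n + 1) a t / 2 by rw [psiD],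
      show (t : ℂ) ^ b * (n * psiD (n - 1) a t - psiD (n + 1) a t / 2) =
        n * (t ^ b * psiD (n - 1) a t) - (t ^ b * psiD (n + 1) a t) / 2 by ring,
      show a + 1 + b = a + b + 1 by ring]
    exact (norm_sub_le _ _).trans (ladder_bound n (a + b) (ih _) (ih _))

/-- The normalised Hermite functions grow subexponentially in `𝒮_{1/2,H}` for suitable `H`. -/
theorem exists_norm_pow_mul_psiD_le {δ : ℝ} (hδ : 0 < δ) :
    ∃ C H : ℝ, 0 < C ∧ 0 < H ∧ ∀ (n a b : ℕ) (t : ℝ), ‖(t : ℂ) ^ b * psiD n a t‖ ≤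
      (C * Real.exp (δ * n) * √((2 : ℝ) ^ n * n !)) * (H ^ (a + b) * √((a ! : ℝ) * (b ! : ℝ))) := by
  set K : ℝ := Real.exp (2 * δ) / (2 * δ) with hK
  have hK0 : 0 < K := by positivity
  refine ⟨2 * √K, 2 * √(4 * K), by positivity, by positivity, fun n a b t => ?_⟩
  refine (norm_pow_mul_psiD_le_sqrt n a b t).trans ?_
  set N := a + b with hN
  have h1 : (n + N + 1 : ℝ) ^ (N + 1) ≤
      K * Real.exp (2 * δ * n) * ((4 * K) ^ N * (a ! * b !)) := by
    -- The inequality $x^k/k!\le e^x$ trades the power for a factorial and $e^{2\delta n}$; the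
    -- factor $e^{2\delta(N+1)}$ goes into $H$. The rate is $2\delta$ because a square root follows.
    have h2 := Real.pow_div_factorial_le_exp (x := 2 * δ * (n + N + 1)) (by positivity) (N + 1)
    rw [div_le_iff₀ (by positivity), mul_pow] at h2
    have h3 : ((N + 1)! : ℝ) ≤ 4 ^ N * (a ! * b !) := by
      have e1 : N + 1 ≤ 2 ^ N := Nat.lt_two_pow_self
      have e2 : (N + 1)! ≤ 2 ^ N * (2 ^ N * (a ! * b !)) := by
        rw [Nat.factorial_succ]
        exact Nat.mul_le_mul e1 (factorial_add_le a b)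
      have e3 : (4 : ℝ) ^ N = 2 ^ N * 2 ^ N := by rw [← mul_pow]; norm_num
      rw [e3, mul_assoc]
      exact_mod_cast e2
    have h4 : Real.exp (2 * δ * (n + N + 1)) =
        Real.exp (2 * δ * n) * Real.exp (2 * δ) ^ (N + 1) := by
      rw [← Real.exp_nat_mul, ← Real.exp_add]
      congr 1
      push_cast
      ring
    rw [h4] at h2
    have h5 : (n + N + 1 : ℝ) ^ (N + 1) ≤ Real.exp (2 * δ * n) * K ^ (N + 1) * (N + 1)! := by
      rw [hK, div_pow, mul_div_assoc', div_mul_eq_mul_div, le_div_iff₀ (by positivity)]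
      linarith
    refine h5.trans ?_
    calc _ ≤ Real.exp (2 * δ * n) * K ^ (N + 1) * (4 ^ N * (a ! * b !)) := by gcongr
      _ = _ := by rw [mul_pow, pow_succ]; ring
  have h6 : √(n + N + 1 : ℝ) ^ (N + 1) ≤
      √K * Real.exp (δ * n) * (√(4 * K) ^ N * √((a ! : ℝ) * b !)) := by
    refine le_of_sq_le_sq ?_ (by positivity)
    have e : ∀ x : ℝ, 0 ≤ x → ∀ k : ℕ, (√x ^ k) ^ 2 = x ^ k := fun x hx k => by
      rw [← pow_mul, mul_comm, pow_mul, Real.sq_sqrt hx]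
    rw [e _ (by positivity), mul_pow, mul_pow, mul_pow, e _ (by positivity),
      Real.sq_sqrt hK0.le, Real.sq_sqrt (by positivity), ← Real.exp_nat_mul]
    refine h1.trans (le_of_eq ?_)
    push_cast
    ring_nf
  calc _ ≤ 2 * √((2 : ℝ) ^ n * n !) * 2 ^ N *
        (√K * Real.exp (δ * n) * (√(4 * K) ^ N * √((a ! : ℝ) * b !))) := by gcongr
    _ = _ := by rw [mul_pow]; ring

/-! ### Orthogonality of the one-dimensional Hermite functions -/

theorem psi_succ (n : ℕ) (t : ℝ) :
    psi (n + 1) t = 2 * ((t : ℂ) * psi n t - n * psi (n - 1) t) := by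
  rw [mul_psi]
  ring

theorem psi_zero (t : ℝ) : psi 0 t = Complex.exp (-((t : ℂ) ^ 2 / 2)) := by
  simp only [psi, gaussDeriv, iteratedDeriv_zero, pow_zero, one_mul, ← Complex.exp_add]
  congr 1
  ring

/-- The recursion `psi_succ` has real coefficients and a real initial function. -/
theorem conj_psi (n : ℕ) (t : ℝ) : starRingEnd ℂ (psi n t) = psi n t := by
  induction n using Nat.strong_induction_on with
  | _ n ih =>
    rcases n with _ | n
    · rw [psi_zero, ← Complex.exp_conj]
      simp [show starRingEnd ℂ 2 = 2 from map_ofNat _ 2]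
    · rw [psi_succ]
      simp only [map_mul, map_sub, map_natCast, map_ofNat, Complex.conj_ofReal,
        ih n (Nat.lt_succ_self n), ih (n - 1) (by omega)]

theorem continuous_psi (n : ℕ) : Continuous (psi n) := (contDiff_psi n).continuous

/-- Adds the bounds for $\psi_n$ and $t^2\psi_n$ with rate $\delta=1$, giving an integrable majorant
with explicit dependence on $n$. The summands $1$ and $H^2\sqrt{2!}$ of the constant are the cases
$b=0$ and $b=2$. -/
theorem exists_norm_psi_le_inv_one_add_sq : ∃ C : ℝ, 0 < C ∧ ∀ (n : ℕ) (t : ℝ),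
    ‖psi n t‖ ≤ C * Real.exp n * √((2 : ℝ) ^ n * n !) * (1 + t ^ 2)⁻¹ := by
  obtain ⟨C, H, hC, hH, h⟩ := exists_norm_pow_mul_psiD_le one_pos
  refine ⟨C * (1 + H ^ 2 * √2), by positivity, fun n t => ?_⟩
  have a1 := h n 0 0 t
  have a2 := h n 0 2 t
  simp only [psiD, pow_zero, one_mul, norm_mul, norm_pow, Complex.norm_real, Real.norm_eq_abs,
    sq_abs, add_zero, zero_add, Nat.factorial_zero, Nat.cast_one, mul_one, Real.sqrt_one,
    Nat.factorial_two, Nat.cast_ofNat] at a1 a2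
  rw [← div_eq_mul_inv, le_div_iff₀ (by positivity)]
  linarith

theorem integrable_psi (n : ℕ) : MeasureTheory.Integrable (psi n) := by
  obtain ⟨C, -, h⟩ := exists_norm_psi_le_inv_one_add_sq
  exact (integrable_inv_one_add_sq.const_mul _).mono' (continuous_psi n).aestronglyMeasurable
    (Filter.Eventually.of_forall (h n))

theorem integrable_psi_mul_psi (n m : ℕ) :
    MeasureTheory.Integrable fun t => psi n t * psi m t :=
  (integrable_psi m).bdd_mul (continuous_psi n).aestronglyMeasurable
    (Filter.Eventually.of_forall fun t => norm_psi_le n t)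

/-- Integration by parts: the ladder relations give
$(\psi_n\psi_m)'=2m\psi_n\psi_{m-1}-\psi_{n+1}\psi_m$, whose integral vanishes. At $m=0$ the
truncated index $m-1$ carries the factor $0$. -/
theorem integral_psi_succ_mul (n m : ℕ) :
    ∫ t, psi (n + 1) t * psi m t = 2 * m * ∫ t, psi n t * psi (m - 1) t := by
  have hd : ∀ t, HasDerivAt (fun t => psi n t * psi m t)
      (2 * m * (psi n t * psi (m - 1) t) - psi (n + 1) t * psi m t) t := fun t => by
    have h := (hasDerivAt_psi n t).mul (hasDerivAt_psi m t)
    refine h.congr_deriv ?_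
    have h1 := mul_psi n t
    have h2 := mul_psi m t
    linear_combination psi n t * h2 - psi m t * h1
  have h1 := (integrable_psi_mul_psi n (m - 1)).const_mul (2 * (m : ℂ))
  have h2 := integrable_psi_mul_psi (n + 1) m
  have h := MeasureTheory.integral_eq_zero_of_hasDerivAt_of_integrable hd (h1.sub h2)
    (integrable_psi_mul_psi n m)
  rw [MeasureTheory.integral_sub h1 h2, MeasureTheory.integral_const_mul] at h
  exact (sub_eq_zero.1 h).symm

theorem integral_psi_mul_psi (n m : ℕ) :
    ∫ t, psi n t * psi m t =
      if n = m then (((2 : ℝ) ^ n * n ! * √Real.pi : ℝ) : ℂ) else 0 := by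
  induction n generalizing m with
  | zero =>
    rcases m with _ | m
    · have : ∀ t : ℝ, psi 0 t * psi 0 t = ((Real.exp (-1 * t ^ 2) : ℝ) : ℂ) := fun t => by
        rw [psi_zero, ← Complex.exp_add]
        push_cast
        congr 1
        ring
      simp only [this]
      rw [integral_complex_ofReal, integral_gaussian]
      simp
    · have := integral_psi_succ_mul m 0
      simp only [mul_comm (psi (m + 1) _)] at this
      rw [this]
      simp
  | succ n ih =>
    rw [integral_psi_succ_mul]
    rcases m with _ | m
    · simp
    · rw [Nat.add_sub_cancel, ih]
      by_cases h : n = m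
      · subst h
        simp only [if_true]
        rw [Nat.factorial_succ]
        push_cast
        ring
      · simp [h]

/-! ### Hermite functions on `ℝ^d` and their derivatives -/

/-- The family is a product of $d$ geometric series: any finite set of multi-indices lies in a box,
over which the sum factorises. -/
theorem summable_exp_neg_degree {d : ℕ} {r : ℝ} (hr : 0 < r) :
    Summable fun γ : MultiIndex d => Real.exp (-(r * γ.degree)) := by
  set q := Real.exp (-r) with hq
  have hq1 : q < 1 := (Real.exp_lt_exp.2 (neg_lt_zero.2 hr)).trans_eq Real.exp_zero
  have hq0 : 0 ≤ q := (Real.exp_pos _).le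
  have he : ∀ γ : MultiIndex d, Real.exp (-(r * γ.degree)) = ∏ j, q ^ γ j := fun γ => by
    rw [Finset.prod_pow_eq_pow_sum, ← Finsupp.degree_eq_sum, hq, ← Real.exp_nat_mul]
    congr 1
    ring
  simp only [he]
  refine summable_of_sum_le (c := ∏ _j : Fin d, (1 - q)⁻¹)
    (fun γ => Finset.prod_nonneg fun _ _ => by positivity) fun s => ?_
  set M := s.sup fun γ => γ.degree with hM
  have hs : ∀ γ ∈ s, (⇑γ : Fin d → ℕ) ∈ Fintype.piFinset fun _ => Finset.range (M + 1) := by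
    intro γ hγ
    rw [Fintype.mem_piFinset]
    intro j
    rw [Finset.mem_range, Nat.lt_succ_iff]
    exact (Finsupp.le_degree j γ).trans (Finset.le_sup (f := fun γ => γ.degree) hγ)
  calc ∑ γ ∈ s, ∏ j, q ^ γ j
      = ∑ a ∈ s.image (fun (γ : MultiIndex d) => (⇑γ : Fin d → ℕ)), ∏ j, q ^ a j := by
        rw [Finset.sum_image fun a _ b _ h => DFunLike.coe_injective h]
    _ ≤ ∑ a ∈ Fintype.piFinset fun _ : Fin d => Finset.range (M + 1), ∏ j, q ^ a j := by
        refine Finset.sum_le_sum_of_subset_of_nonneg ?_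
          fun _ _ _ => Finset.prod_nonneg fun _ _ => by positivity
        intro a ha
        obtain ⟨γ, hγ, rfl⟩ := Finset.mem_image.1 ha
        exact hs γ hγ
    _ = ∏ _j : Fin d, ∑ n ∈ Finset.range (M + 1), q ^ n :=
        (Finset.prod_univ_sum (fun _ => Finset.range (M + 1)) fun _ n => q ^ n).symm
    _ ≤ _ := by
        refine Finset.prod_le_prod (fun _ _ => Finset.sum_nonneg fun _ _ => by positivity)
          fun _ _ => ?_
        rw [← tsum_geometric_of_lt_one hq0 hq1]
        exact (summable_geometric_of_lt_one hq0 hq1).sum_le_tsum _ fun _ _ => by positivity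

/-- The derivative `∂^m h_γ`. -/
noncomputable def hermiteD {d : ℕ} (m : Fin d → ℕ) (γ : MultiIndex d) (x : Fin d → ℝ) : ℂ :=
  hermiteConst γ * ∏ k, psiD (γ k) (m k) (x k)

theorem hermiteFun_eq_hermiteD {d : ℕ} (γ : MultiIndex d) : hermiteFun γ = hermiteD 0 γ := by
  rw [hermiteFun_eq]
  funext x
  simp only [hermiteD, Pi.smul_apply, smul_eq_mul, Pi.zero_apply, psiD]

theorem norm_hermiteConst {d : ℕ} (γ : MultiIndex d) :
    ‖hermiteConst γ‖ = Real.pi ^ (-(d : ℝ) / 4) * ∏ k, (√((2 : ℝ) ^ γ k * (γ k)!))⁻¹ := by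
  rw [hermiteConst, Complex.norm_real, Real.norm_of_nonneg (by positivity)]
  congr 1
  have : (2 : ℝ) ^ γ.degree * (mfact γ : ℝ) = ∏ k, ((2 : ℝ) ^ γ k * (γ k)!) := by
    rw [Finset.prod_mul_distrib, Finset.prod_pow_eq_pow_sum, ← Finsupp.degree_eq_sum, mfact]
    push_cast
    rfl
  rw [this, Real.rpow_neg (Finset.prod_nonneg fun _ _ => by positivity), ← Real.sqrt_eq_rpow,
    Real.sqrt_prod _ fun _ _ => by positivity, Finset.prod_inv_distrib]

/-- For every `δ > 0`, the functions `e^{-δ|γ|} h_γ` are bounded in some `𝒮_{1/2,H}(ℝ^d)`. -/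
theorem exists_norm_monom_mul_hermiteD_le (d : ℕ) {δ : ℝ} (hδ : 0 < δ) :
    ∃ C H : ℝ, 0 < C ∧ 0 < H ∧ ∀ (γ α β : MultiIndex d) (x : Fin d → ℝ),
      ‖(monom β x : ℂ) * hermiteD α γ x‖ ≤ C * Real.exp (δ * γ.degree) *
        (H ^ (α.degree + β.degree) * ((mfact α : ℝ) * (mfact β : ℝ)) ^ (1 / 2 : ℝ)) := by
  obtain ⟨C, H, hC, hH, h⟩ := exists_norm_pow_mul_psiD_le hδ
  refine ⟨Real.pi ^ (-(d : ℝ) / 4) * C ^ d, H, by positivity, hH, fun γ α β x => ?_⟩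
  have h1 : (monom β x : ℂ) * hermiteD α γ x =
      hermiteConst γ * ∏ j, ((x j : ℂ) ^ β j * psiD (γ j) (α j) (x j)) := by
    rw [Finset.prod_mul_distrib, monom, hermiteD]
    push_cast
    ring
  rw [h1, norm_mul, norm_prod, norm_hermiteConst]
  calc _ ≤ Real.pi ^ (-(d : ℝ) / 4) * (∏ k, (√((2 : ℝ) ^ γ k * (γ k)!))⁻¹) *
        ∏ j, ((C * Real.exp (δ * γ j) * √((2 : ℝ) ^ γ j * (γ j)!)) *
          (H ^ (α j + β j) * √(((α j)! : ℝ) * ((β j)! : ℝ)))) := by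
        refine mul_le_mul_of_nonneg_left
          (Finset.prod_le_prod (fun _ _ => norm_nonneg _) fun j _ => h _ _ _ _) ?_
        exact mul_nonneg (by positivity) (Finset.prod_nonneg fun _ _ => by positivity)
    _ = Real.pi ^ (-(d : ℝ) / 4) * ∏ j, (C * Real.exp (δ * γ j) *
          (H ^ (α j + β j) * √(((α j)! : ℝ) * ((β j)! : ℝ)))) := by
        rw [mul_assoc, ← Finset.prod_mul_distrib]
        congr 1
        refine Finset.prod_congr rfl fun j _ => ?_
        have : √((2 : ℝ) ^ γ j * (γ j)!) ≠ 0 := (Real.sqrt_pos.2 (by positivity)).ne'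
        field_simp
    _ = _ := by
        have e : ∏ j, Real.exp (δ * γ j) = Real.exp (δ * γ.degree) := by
          rw [← Real.exp_sum, ← Finset.mul_sum, Finsupp.degree_eq_sum]
          push_cast
          rfl
        rw [Finset.prod_mul_distrib, Finset.prod_mul_distrib, Finset.prod_mul_distrib, e,
          Finset.prod_pow_eq_pow_sum, Finset.sum_add_distrib, ← Finsupp.degree_eq_sum,
          ← Finsupp.degree_eq_sum, ← Real.sqrt_eq_rpow,
          ← Real.sqrt_prod _ (fun _ _ => by positivity), Finset.prod_mul_distrib]
        simp only [mfact, Finset.prod_const, Finset.card_univ, Fintype.card_fin]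
        push_cast
        ring

/-- The coordinate functional `x ↦ x j` on `ℝ^d`. -/
abbrev coordProj {d : ℕ} (j : Fin d) : (Fin d → ℝ) →L[ℝ] ℝ := ContinuousLinearMap.proj j

/-- The real linear form `x ↦ ∑ j, x j * v j`. -/
noncomputable def coordForm {d : ℕ} (v : Fin d → ℂ) : (Fin d → ℝ) →L[ℝ] ℂ :=
  ∑ j, (coordProj j).smulRight (v j)

theorem coordForm_single {d : ℕ} (v : Fin d → ℂ) (j : Fin d) :
    coordForm v (Pi.single j 1) = v j := by
  simp [coordForm, Pi.single_apply, _root_.sum_apply]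

theorem norm_coordForm_le {d : ℕ} (v : Fin d → ℂ) : ‖coordForm v‖ ≤ ∑ j, ‖v j‖ := by
  refine ContinuousLinearMap.opNorm_le_bound _ (Finset.sum_nonneg fun _ _ => norm_nonneg _)
    fun x => ?_
  rw [coordForm, _root_.sum_apply, Finset.sum_mul]
  refine (norm_sum_le _ _).trans (Finset.sum_le_sum fun j _ => ?_)
  simp only [ContinuousLinearMap.smulRight_apply, coordProj, ContinuousLinearMap.proj_apply, norm_smul]
  rw [mul_comm]
  gcongr
  exact norm_le_pi_norm x j

theorem hasSum_coordForm {d : ℕ} {ι : Type*} {v : ι → Fin d → ℂ} {w : Fin d → ℂ}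
    (h : ∀ j, HasSum (fun i => v i j) (w j)) :
    HasSum (fun i => coordForm (v i)) (coordForm w) :=
  hasSum_sum fun j _ => (ContinuousLinearMap.smulRightL ℝ (Fin d → ℝ) ℂ
    (coordProj j)).hasSum (h j)

theorem hasFDerivAt_hermiteD {d : ℕ} (m : Fin d → ℕ) (γ : MultiIndex d) (x : Fin d → ℝ) :
    HasFDerivAt (hermiteD m γ)
      (coordForm fun j => hermiteD (Function.update m j (m j + 1)) γ x) x := by
  have h1 : ∀ j ∈ Finset.univ, HasFDerivAt (fun y : Fin d → ℝ => psiD (γ j) (m j) (y j))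
      ((coordProj j).smulRight
        (psiD (γ j) (m j + 1) (x j))) x := by
    intro j _
    have h2 := (hasDerivAt_psiD (γ j) (m j) (x j)).hasFDerivAt.comp x
      (coordProj j).hasFDerivAt
    refine h2.congr_fderiv ?_
    ext y
    simp
  have h3 := (HasFDerivAt.finsetProd h1).const_mul (hermiteConst γ)
  refine h3.congr_fderiv ?_
  rw [coordForm, Finset.smul_sum]
  refine Finset.sum_congr rfl fun j _ => ?_
  ext y
  simp only [_root_.smul_apply, ContinuousLinearMap.smulRight_apply, smul_eq_mul,
    hermiteD, coordProj, ContinuousLinearMap.proj_apply, Complex.real_smul]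
  rw [← Finset.mul_prod_erase (s := Finset.univ)
    (f := fun k => psiD (γ k) (Function.update m j (m j + 1) k) (x k)) (h := Finset.mem_univ j)]
  have h4 : ∏ k ∈ Finset.univ.erase j, psiD (γ k) (Function.update m j (m j + 1) k) (x k) =
      ∏ k ∈ Finset.univ.erase j, psiD (γ k) (m k) (x k) :=
    Finset.prod_congr rfl fun k hk => by
      rw [Function.update_of_ne (Finset.ne_of_mem_erase hk)]
  rw [Function.update_self, h4]
  ring

/-! ### Hermite series with exponentially decaying coefficients -/

/-- The coefficient sequences with `|c(γ)| ≤ C e^{-r|γ|}` for some `r > 0`. -/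
def ExpDecay {d : ℕ} (c : HermiteSeries d) : Prop :=
  ∃ r : ℝ, 0 < r ∧ ∃ C : ℝ, ∀ γ, ‖c γ‖ ≤ C * Real.exp (-(r * γ.degree))

/-- Half of the decay rate pays for summability; the other half is kept as the weight that absorbs
the growth of $h_\gamma$. -/
theorem ExpDecay.exists_summable {d : ℕ} {c : HermiteSeries d} (hc : ExpDecay c) :
    ∃ δ : ℝ, 0 < δ ∧ Summable fun γ => ‖c γ‖ * Real.exp (δ * γ.degree) := by
  obtain ⟨r, hr, C, h⟩ := hc
  refine ⟨r / 2, half_pos hr, Summable.of_nonneg_of_le (fun _ => by positivity) (fun γ => ?_)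
    ((summable_exp_neg_degree (d := d) (half_pos hr)).mul_left C)⟩
  calc ‖c γ‖ * Real.exp (r / 2 * γ.degree)
      ≤ C * Real.exp (-(r * γ.degree)) * Real.exp (r / 2 * γ.degree) := by gcongr; exact h γ
    _ = _ := by
      rw [mul_assoc, ← Real.exp_add]
      congr 2
      ring

/-- The termwise derivative `∑_γ c(γ) ∂^m h_γ`. -/
noncomputable def hermiteSum {d : ℕ} (c : HermiteSeries d) (m : Fin d → ℕ) (x : Fin d → ℝ) : ℂ :=
  ∑' γ, c γ * hermiteD m γ x

theorem ExpDecay.exists_bound {d : ℕ} {c : HermiteSeries d} (hc : ExpDecay c) (m : Fin d → ℕ) :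
    ∃ u : MultiIndex d → ℝ, Summable u ∧ ∀ γ x, ‖c γ * hermiteD m γ x‖ ≤ u γ := by
  obtain ⟨δ, hδ, hs⟩ := hc.exists_summable
  obtain ⟨C, H, hC, hH, h⟩ := exists_norm_monom_mul_hermiteD_le d hδ
  have hm : ∃ α : MultiIndex d, ⇑α = m := ⟨Finsupp.equivFunOnFinite.symm m, rfl⟩
  obtain ⟨α, rfl⟩ := hm
  refine ⟨_, hs.mul_right (C * (H ^ (α.degree + (0 : MultiIndex d).degree) *
    ((mfact α : ℝ) * (mfact (0 : MultiIndex d) : ℝ)) ^ (1 / 2 : ℝ))), fun γ x => ?_⟩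
  have h1 := h γ α 0 x
  simp only [monom, Finsupp.coe_zero, Pi.zero_apply, pow_zero, Finset.prod_const_one,
    Complex.ofReal_one, one_mul] at h1
  rw [norm_mul]
  calc _ ≤ _ := mul_le_mul_of_nonneg_left h1 (norm_nonneg _)
    _ = _ := by ring

theorem ExpDecay.summable {d : ℕ} {c : HermiteSeries d} (hc : ExpDecay c) (m : Fin d → ℕ)
    (x : Fin d → ℝ) : Summable fun γ => c γ * hermiteD m γ x := by
  obtain ⟨u, hu, h⟩ := hc.exists_bound m
  exact Summable.of_norm_bounded hu fun γ => h γ x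

/-- Termwise differentiation, justified by the majorants of `exists_bound` for the $d$ first-order
derivatives, summed over $j$. -/
theorem ExpDecay.hasFDerivAt_hermiteSum {d : ℕ} {c : HermiteSeries d} (hc : ExpDecay c)
    (m : Fin d → ℕ) (x : Fin d → ℝ) :
    HasFDerivAt (hermiteSum c m)
      (coordForm fun j => hermiteSum c (Function.update m j (m j + 1)) x) x := by
  choose u hu h using fun j => hc.exists_bound (Function.update m j (m j + 1))
  have h1 := hasFDerivAt_tsum (𝕜 := ℝ) (u := fun γ => ∑ j, u j γ)
    (f := fun γ x => c γ * hermiteD m γ x)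
    (f' := fun γ x => coordForm fun j => c γ * hermiteD (Function.update m j (m j + 1)) γ x)
    (summable_sum fun j _ => hu j)
    (fun γ y => ((hasFDerivAt_hermiteD m γ y).const_mul (c γ)).congr_fderiv (by
      ext z
      simp only [coordForm, _root_.smul_apply, _root_.sum_apply,
        ContinuousLinearMap.smulRight_apply, smul_eq_mul, Finset.mul_sum, Complex.real_smul]
      exact Finset.sum_congr rfl fun _ _ => by ring))
    (fun γ y => (norm_coordForm_le _).trans (Finset.sum_le_sum fun j _ => h j γ y))
    (hc.summable m x) x
  refine h1.congr_fderiv ?_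
  exact (hasSum_coordForm fun j => (hc.summable (Function.update m j (m j + 1)) x).hasSum).tsum_eq

theorem ExpDecay.contDiff_hermiteSum {d : ℕ} {c : HermiteSeries d} (hc : ExpDecay c)
    (m : Fin d → ℕ) : ContDiff ℝ ∞ (hermiteSum c m) := by
  rw [contDiff_infty]
  intro n
  -- The derivative of a termwise sum is built from termwise sums of one order higher, so the
  -- induction has to cover all $m$ at once.
  induction n generalizing m with
  | zero =>
    exact contDiff_zero.2 (continuous_iff_continuousAt.2 fun x =>
      (hc.hasFDerivAt_hermiteSum m x).continuousAt)
  | succ n ih =>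
    push_cast
    refine contDiff_succ_iff_hasFDerivAt.2 ⟨_, ?_, hc.hasFDerivAt_hermiteSum m⟩
    simp only [coordForm]
    exact ContDiff.sum fun j _ =>
      (contDiff_const (c := coordProj (d := d) j)).smulRight (ih _)

theorem ExpDecay.partialDeriv_hermiteSum {d : ℕ} {c : HermiteSeries d} (hc : ExpDecay c)
    (m : Fin d → ℕ) (j : Fin d) :
    partialDeriv j (hermiteSum c m) = hermiteSum c (Function.update m j (m j + 1)) := by
  funext x
  rw [partialDeriv, ((hc.hasFDerivAt_hermiteSum m x).hasLineDerivAt _).lineDeriv,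
    coordForm_single]

theorem ExpDecay.iterate_partialDeriv_hermiteSum {d : ℕ} {c : HermiteSeries d} (hc : ExpDecay c)
    (m : Fin d → ℕ) (j : Fin d) (n : ℕ) :
    (partialDeriv j)^[n] (hermiteSum c m) = hermiteSum c (Function.update m j (m j + n)) := by
  induction n with
  | zero => simp
  | succ n ih =>
    rw [Function.iterate_succ_apply', ih, hc.partialDeriv_hermiteSum]
    simp [add_assoc]

theorem ExpDecay.iteratedPartial_hermiteSum {d : ℕ} {c : HermiteSeries d} (hc : ExpDecay c)
    (α : MultiIndex d) : iteratedPartial α (hermiteSum c 0) = hermiteSum c α := by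
  have key : ∀ l : List (Fin d), l.Nodup →
      l.foldr (fun j g => (partialDeriv j)^[α j] g) (hermiteSum c 0) =
        hermiteSum c fun k => if k ∈ l then α k else 0 := by
    intro l hl
    induction l with
    | nil => simp [Pi.zero_def]
    | cons j l ih =>
      rw [List.nodup_cons] at hl
      rw [List.foldr_cons, ih hl.2, hc.iterate_partialDeriv_hermiteSum]
      congr 1
      funext k
      by_cases hk : k = j
      · subst hk
        simp [hl.1]
      · simp [hk]
  rw [iteratedPartial, key _ (List.nodup_finRange d)]
  simp

/-- The order of quantifiers matters: $H$ depends on $\delta$ and not on $c$, so that a limit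
seminorm needs only its bound on one step $\mathcal S_{1/2,H}$. -/
theorem exists_gsNorm_hermiteSum_le (d : ℕ) {δ : ℝ} (hδ : 0 < δ) :
    ∃ C H : ℝ, 0 < C ∧ 0 < H ∧ ∀ c : HermiteSeries d, ExpDecay c →
      (Summable fun γ => ‖c γ‖ * Real.exp (δ * γ.degree)) →
      gsNorm (1 / 2) H (hermiteSum c 0) ≤
        ENNReal.ofReal (C * ∑' γ, ‖c γ‖ * Real.exp (δ * γ.degree)) := by
  obtain ⟨C, H, hC, hH, h⟩ := exists_norm_monom_mul_hermiteD_le d hδ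
  refine ⟨C, H, hC, hH, fun c hc hs => gsNorm_le_iff.2 fun α β x => ENNReal.ofReal_le_ofReal ?_⟩
  have hm : (0 : ℝ) < ((mfact α : ℝ) * (mfact β : ℝ)) ^ (1 / 2 : ℝ) :=
    Real.rpow_pos_of_pos (mul_pos (mfact_pos α) (mfact_pos β)) _
  rw [div_le_iff₀ (by positivity), hc.iteratedPartial_hermiteSum, hermiteSum, ← tsum_mul_left,
    ← tsum_mul_left, ← tsum_mul_right]
  refine tsum_of_norm_bounded ((hs.mul_left C).mul_right _).hasSum fun γ => ?_
  rw [mul_left_comm, norm_mul]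
  calc _ ≤ _ := mul_le_mul_of_nonneg_left (h γ α β x) (norm_nonneg _)
    _ = _ := by ring

theorem expDecay_single {d : ℕ} (γ : MultiIndex d) : ExpDecay (Pi.single γ (1 : ℂ)) := by
  refine ⟨1, one_pos, Real.exp γ.degree, fun α => ?_⟩
  by_cases h : α = γ
  · subst h
    simp [← Real.exp_add]
  · rw [Pi.single_eq_of_ne h, norm_zero]
    positivity

theorem hermiteSum_single {d : ℕ} (γ : MultiIndex d) :
    hermiteSum (Pi.single γ (1 : ℂ)) 0 = hermiteFun γ := by
  funext x
  rw [hermiteSum, tsum_eq_single γ fun α hα => by rw [Pi.single_eq_of_ne hα, zero_mul],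
    hermiteFun_eq_hermiteD, Pi.single_eq_same, one_mul]

theorem exists_gsNorm_hermiteFun_le (d : ℕ) {δ : ℝ} (hδ : 0 < δ) :
    ∃ C H : ℝ, 0 < C ∧ 0 < H ∧ ∀ γ : MultiIndex d,
      gsNorm (1 / 2) H (hermiteFun γ) ≤ ENNReal.ofReal (C * Real.exp (δ * γ.degree)) := by
  obtain ⟨C, H, hC, hH, h⟩ := exists_gsNorm_hermiteSum_le d hδ
  refine ⟨C, H, hC, hH, fun γ => ?_⟩
  have h0 : ∀ α ≠ γ, ‖(Pi.single γ (1 : ℂ) : HermiteSeries d) α‖ * Real.exp (δ * α.degree) = 0 :=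
    fun α hα => by rw [Pi.single_eq_of_ne hα, norm_zero, zero_mul]
  have h1 := h _ (expDecay_single γ) (summable_of_ne_finset_zero (s := {γ})
    fun α hα => h0 α (by simpa using hα))
  rw [tsum_eq_single γ h0, hermiteSum_single, Pi.single_eq_same, norm_one, one_mul] at h1
  exact h1

/-! ### Orthonormality and Hermite coefficients -/

theorem conj_hermiteFun {d : ℕ} (γ : MultiIndex d) (x : Fin d → ℝ) :
    starRingEnd ℂ (hermiteFun γ x) = hermiteFun γ x := by
  rw [hermiteFun_eq]
  simp only [Pi.smul_apply, smul_eq_mul, map_mul, map_prod, conj_psi, hermiteConst,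
    Complex.conj_ofReal]

theorem integrable_hermiteFun {d : ℕ} (γ : MultiIndex d) :
    MeasureTheory.Integrable (hermiteFun γ) := by
  rw [hermiteFun_eq]
  exact (MeasureTheory.Integrable.fintype_prod fun j => integrable_psi (γ j)).smul _

/-- In each coordinate the majorant of `exists_norm_psi_le_inv_one_add_sq` integrates to a multiple
of $\pi$, and its factor $\sqrt{2^n n!}$ cancels the normalisation. -/
theorem exists_integral_norm_hermiteFun_le (d : ℕ) :
    ∃ C : ℝ, ∀ γ : MultiIndex d, ∫ x, ‖hermiteFun γ x‖ ≤ C * Real.exp γ.degree := by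
  obtain ⟨C, hC, h⟩ := exists_norm_psi_le_inv_one_add_sq
  refine ⟨Real.pi ^ (-(d : ℝ) / 4) * (C * Real.pi) ^ d, fun γ => ?_⟩
  have h1 : ∀ n, ∫ t, ‖psi n t‖ ≤ C * Real.exp n * √((2 : ℝ) ^ n * n !) * Real.pi := fun n => by
    rw [← integral_univ_inv_one_add_sq, ← MeasureTheory.integral_const_mul]
    exact MeasureTheory.integral_mono (integrable_psi n).norm
      (integrable_inv_one_add_sq.const_mul _) (h n)
  simp only [hermiteFun_eq, Pi.smul_apply, smul_eq_mul, norm_mul, norm_prod]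
  rw [MeasureTheory.integral_const_mul, MeasureTheory.integral_fintype_prod_volume_eq_prod
    (fun j t => ‖psi (γ j) t‖), norm_hermiteConst, mul_assoc, ← Finset.prod_mul_distrib, mul_assoc]
  refine mul_le_mul_of_nonneg_left ?_ (by positivity)
  have e : (C * Real.pi) ^ d * Real.exp γ.degree = ∏ j, (C * Real.pi * Real.exp (γ j)) := by
    rw [Finset.prod_mul_distrib, ← Real.exp_sum, Finsupp.degree_eq_sum]
    simp
  rw [e]
  refine Finset.prod_le_prod (fun j _ => mul_nonneg (by positivity)
    (MeasureTheory.integral_nonneg fun _ => norm_nonneg _)) fun j _ => ?_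
  rw [inv_mul_le_iff₀ (Real.sqrt_pos.2 (by positivity))]
  exact (h1 (γ j)).trans (le_of_eq (by ring))

theorem integral_hermiteFun_mul {d : ℕ} (γ α : MultiIndex d) :
    ∫ x, hermiteFun γ x * hermiteFun α x = if γ = α then 1 else 0 := by
  have h1 : ∀ x, hermiteFun γ x * hermiteFun α x = hermiteConst γ * hermiteConst α *
      ∏ j, psi (γ j) (x j) * psi (α j) (x j) := fun x => by
    rw [hermiteFun_eq, hermiteFun_eq, Finset.prod_mul_distrib]
    simp only [Pi.smul_apply, smul_eq_mul]
    ring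
  simp only [h1]
  rw [MeasureTheory.integral_const_mul, MeasureTheory.integral_fintype_prod_volume_eq_prod
    (fun j t => psi (γ j) t * psi (α j) t)]
  simp only [integral_psi_mul_psi]
  split_ifs with h
  · subst h
    simp only [if_true]
    have h2 : hermiteConst γ = ((‖hermiteConst γ‖ : ℝ) : ℂ) := by
      rw [hermiteConst, Complex.norm_real, Real.norm_of_nonneg (by positivity)]
    rw [h2, norm_hermiteConst, ← Complex.ofReal_prod, ← Complex.ofReal_mul, ← Complex.ofReal_mul,
      ← Complex.ofReal_one]
    congr 1
    rw [mul_mul_mul_comm, ← Finset.prod_mul_distrib, mul_assoc, ← Finset.prod_mul_distrib]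
    have h3 : ∀ j, (√((2 : ℝ) ^ γ j * (γ j)!))⁻¹ * (√((2 : ℝ) ^ γ j * (γ j)!))⁻¹ *
        (2 ^ γ j * (γ j)! * √Real.pi) = √Real.pi := fun j => by
      rw [← mul_inv, Real.mul_self_sqrt (by positivity)]
      field_simp
    simp only [h3, Finset.prod_const, Finset.card_univ, Fintype.card_fin]
    -- The exponents of $\pi$ are $-d/4$, $-d/4$ and $d/2$.
    rw [← Real.rpow_add Real.pi_pos, Real.sqrt_eq_rpow, ← Real.rpow_natCast,
      ← Real.rpow_mul Real.pi_pos.le, ← Real.rpow_add Real.pi_pos]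
    convert Real.rpow_zero _
    ring
  · obtain ⟨j, hj⟩ : ∃ j, γ j ≠ α j := by
      by_contra! h'
      exact h (Finsupp.ext h')
    rw [Finset.prod_eq_zero (Finset.mem_univ j) (by rw [if_neg hj]), mul_zero]

/-- Sum and integral may be exchanged because $c(\gamma)h_\gamma$ has uniform bounds summable in
$\gamma$ and $h_\alpha$ is integrable; orthonormality leaves one term. -/
theorem ExpDecay.integral_hermiteSum_mul {d : ℕ} {c : HermiteSeries d} (hc : ExpDecay c)
    (α : MultiIndex d) :
    ∫ x, hermiteSum c 0 x * starRingEnd ℂ (hermiteFun α x) = c α := by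
  obtain ⟨u, hu, h⟩ := hc.exists_bound 0
  have h0 : ∀ γ x, hermiteD (0 : Fin d → ℕ) γ x = hermiteFun γ x := fun γ x => by
    rw [hermiteFun_eq_hermiteD]
  have hcont : ∀ γ : MultiIndex d, Continuous (hermiteFun γ) := fun γ => (hermiteFun_mem γ).1.continuous
  simp only [conj_hermiteFun, hermiteSum, ← tsum_mul_right, h0] at h ⊢
  have hint : ∀ γ, MeasureTheory.Integrable fun x => c γ * hermiteFun γ x * hermiteFun α x :=
    fun γ => (integrable_hermiteFun α).bdd_mul
      (continuous_const.mul (hcont γ)).aestronglyMeasurable (Filter.Eventually.of_forall (h γ))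
  rw [← MeasureTheory.integral_tsum_of_summable_integral_norm hint]
  · rw [tsum_eq_single α]
    · simp only [mul_assoc, MeasureTheory.integral_const_mul, integral_hermiteFun_mul, if_true,
        mul_one]
    · intro γ hγ
      simp only [mul_assoc, MeasureTheory.integral_const_mul, integral_hermiteFun_mul, if_neg hγ,
        mul_zero]
  · refine Summable.of_nonneg_of_le (fun γ => MeasureTheory.integral_nonneg fun _ => norm_nonneg _)
      (fun γ => ?_) (hu.mul_right (∫ x, ‖hermiteFun α x‖))
    rw [← MeasureTheory.integral_const_mul]
    refine MeasureTheory.integral_mono (hint γ).norm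
      ((integrable_hermiteFun α).norm.const_mul _) fun x => ?_
    simp only [norm_mul (_ * _)]
    exact mul_le_mul_of_nonneg_right (h γ x) (norm_nonneg _)

/-! ### Bounded sets and null sequences of Hermite functions -/

/-- A limit seminorm is bounded on every step $\mathcal S_{1/2,H}$, so $H$ may be chosen after
$\delta$. -/
theorem IsLimitSeminorm.exists_hermiteGS_le {d : ℕ} {p : Seminorm ℂ (GelfandShilov (1 / 2) d)}
    (hp : IsLimitSeminorm p) {δ : ℝ} (hδ : 0 < δ) :
    ∃ C : ℝ, 0 ≤ C ∧ ∀ γ, p (hermiteGS γ) ≤ C * Real.exp (δ * γ.degree) := by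
  obtain ⟨C, H, hC, hH, h⟩ := exists_gsNorm_hermiteFun_le d hδ
  obtain ⟨K, hK⟩ := hp H hH
  refine ⟨K * C, by positivity, fun γ => ?_⟩
  have h1 := (hK (hermiteGS γ) ((h γ).trans_lt ENNReal.ofReal_lt_top)).trans
    (mul_le_mul_right (h γ) _)
  rw [← ENNReal.ofReal_coe_nnreal, ← ENNReal.ofReal_mul K.coe_nonneg] at h1
  have h2 := (ENNReal.ofReal_le_ofReal_iff (by positivity)).1 h1
  rwa [← mul_assoc] at h2

/-- The rescaled Hermite function `e^{-δ|γ|} h_γ`. -/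
noncomputable def dampedHermite {d : ℕ} (δ : ℝ) (γ : MultiIndex d) : GelfandShilov (1 / 2) d :=
  (Real.exp (-(δ * γ.degree)) : ℂ) • hermiteGS γ

theorem IsLimitSeminorm.exists_dampedHermite_le {d : ℕ}
    {p : Seminorm ℂ (GelfandShilov (1 / 2) d)} (hp : IsLimitSeminorm p) (δ : ℝ) {ε : ℝ}
    (hε : 0 < ε) :
    ∃ C : ℝ, 0 ≤ C ∧ ∀ γ, p (dampedHermite δ γ) ≤ C * Real.exp ((ε - δ) * γ.degree) := by
  obtain ⟨C, hC, h⟩ := hp.exists_hermiteGS_le hε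
  refine ⟨C, hC, fun γ => ?_⟩
  rw [dampedHermite, map_smul_eq_mul, Complex.norm_real, Real.norm_of_nonneg (Real.exp_pos _).le]
  calc _ ≤ Real.exp (-(δ * γ.degree)) * (C * Real.exp (ε * γ.degree)) := by gcongr; exact h γ
    _ = _ := by
      rw [mul_left_comm, ← Real.exp_add]
      congr 2
      ring

theorem isVonNBounded_dampedHermite (d : ℕ) {δ : ℝ} (hδ : 0 < δ) :
    Bornology.IsVonNBounded ℂ (Set.range (dampedHermite (d := d) δ)) := by
  rw [(withSeminorms_limitSeminorms (1 / 2) d).isVonNBounded_iff_seminorm_bounded]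
  intro p
  obtain ⟨C, hC, h⟩ := p.2.exists_dampedHermite_le δ hδ
  refine ⟨C + 1, by positivity, ?_⟩
  rintro _ ⟨γ, rfl⟩
  have := h γ
  rw [sub_self, zero_mul, Real.exp_zero, mul_one] at this
  exact this.trans_lt (lt_add_one C)

theorem tendsto_dampedHermite {d : ℕ} {δ : ℝ} (hδ : 0 < δ) (j : Fin d) :
    Filter.Tendsto (fun n : ℕ => dampedHermite δ (Finsupp.single j n)) Filter.atTop (nhds 0) := by
  rw [(withSeminorms_limitSeminorms (1 / 2) d).tendsto_nhds]
  intro p ε hε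
  obtain ⟨C, hC, h⟩ := p.2.exists_dampedHermite_le δ (half_pos hδ)
  have hlim : Filter.Tendsto (fun n : ℕ => C * Real.exp ((δ / 2 - δ) * n)) Filter.atTop
      (nhds 0) := by
    have h1 : Filter.Tendsto (fun n : ℕ => (δ / 2 - δ) * (n : ℝ)) Filter.atTop Filter.atBot :=
      tendsto_natCast_atTop_atTop.const_mul_atTop_of_neg (by linarith)
    simpa using (Real.tendsto_exp_atBot.comp h1).const_mul C
  filter_upwards [hlim.eventually (gt_mem_nhds hε)] with n hn
  have := h (Finsupp.single j n)
  rw [Finsupp.degree_single] at this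
  rw [sub_zero]
  exact this.trans_lt hn

/-! ### Coefficient growth -/

/-- A continuous functional is bounded on the bounded set of all $e^{-\delta|\gamma|}h_\gamma$. -/
theorem exists_norm_le_of_mem_gsDualSet {d : ℕ} {c : HermiteSeries d} (hc : c ∈ gsDualSet d)
    {δ : ℝ} (hδ : 0 < δ) : ∃ C : ℝ, ∀ γ, ‖c γ‖ ≤ C * Real.exp (δ * γ.degree) := by
  obtain ⟨u, rfl⟩ := hc
  have h1 := (isVonNBounded_dampedHermite d hδ).image u
  rw [NormedSpace.isVonNBounded_iff] at h1
  obtain ⟨C, hC⟩ := h1.exists_norm_le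
  refine ⟨C, fun γ => ?_⟩
  have h2 := hC _ ⟨_, ⟨γ, rfl⟩, rfl⟩
  rw [dampedHermite, map_smul, norm_smul, Complex.norm_real,
    Real.norm_of_nonneg (Real.exp_pos _).le, Real.exp_neg, inv_mul_le_iff₀ (Real.exp_pos _)] at h2
  rw [mul_comm C]
  exact h2

/-- The case $\alpha=\beta=0$ of the norm bounds $f$ itself, and
$\|h_\gamma\|_{L^1}=O(e^{|\gamma|})$. This places $\mathcal S_{1/2}$ in $\mathcal H_{0,1/2}'$ and
excludes $e^{2|\gamma|}$ from it. -/
theorem exists_norm_le_of_mem_gsSet {d : ℕ} {c : HermiteSeries d} (hc : c ∈ gsSet d) :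
    ∃ C : ℝ, ∀ γ, ‖c γ‖ ≤ C * Real.exp γ.degree := by
  obtain ⟨f, rfl⟩ := hc
  obtain ⟨hf, h, hh, hn⟩ := f.2
  obtain ⟨C, hC⟩ := exists_integral_norm_hermiteFun_le d
  have hb : ∀ x, ‖f.toFun x‖ ≤ (gsNorm (1 / 2) h f.1).toReal := fun x => by
    have h1 := gsNorm_le_iff.1 (le_refl (gsNorm (1 / 2) h f.1)) 0 0 x
    have h2 : iteratedPartial 0 f.1 = f.1 := by
      have : ∀ l : List (Fin d), l.foldr
          (fun j g => (partialDeriv j)^[(0 : MultiIndex d) j] g) f.1 = f.1 := by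
        intro l
        induction l with
        | nil => rfl
        | cons j l ih => rw [List.foldr_cons, ih]; rfl
      exact this _
    rw [h2] at h1
    refine (ENNReal.ofReal_le_iff_le_toReal hn.ne).1 (le_trans (le_of_eq ?_) h1)
    simp [monom, mfact, GelfandShilov.toFun]
  set M := (gsNorm (1 / 2) h f.1).toReal with hM
  refine ⟨M * C, fun γ => ?_⟩
  rw [GelfandShilov.series]
  refine (MeasureTheory.norm_integral_le_integral_norm _).trans ?_
  calc ∫ x, ‖f.toFun x * starRingEnd ℂ (hermiteFun γ x)‖
      ≤ ∫ x, M * ‖hermiteFun γ x‖ := by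
        refine MeasureTheory.integral_mono_of_nonneg
          (Filter.Eventually.of_forall fun _ => norm_nonneg _)
          ((integrable_hermiteFun γ).norm.const_mul M) (Filter.Eventually.of_forall fun x => ?_)
        simp only [norm_mul, RCLike.norm_conj]
        exact mul_le_mul_of_nonneg_right (hb x) (norm_nonneg _)
    _ = M * ∫ x, ‖hermiteFun γ x‖ := MeasureTheory.integral_const_mul _ _
    _ ≤ M * (C * Real.exp γ.degree) := by
        gcongr
        exact hC γ
    _ = _ := by ring

/-- The element `∑_γ c(γ) h_γ` of `𝒮_{1/2}(ℝ^d)`. -/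
noncomputable def ExpDecay.toGS {d : ℕ} {c : HermiteSeries d} (hc : ExpDecay c) :
    GelfandShilov (1 / 2) d :=
  (⟨hermiteSum c 0, hc.contDiff_hermiteSum 0, by
    obtain ⟨δ, hδ, hs⟩ := hc.exists_summable
    obtain ⟨C, H, -, hH, h⟩ := exists_gsNorm_hermiteSum_le d hδ
    exact ⟨H, hH, (h c hc hs).trans_lt ENNReal.ofReal_lt_top⟩⟩ : ↥(gsSubmodule (1 / 2) d))

theorem ExpDecay.series_toGS {d : ℕ} {c : HermiteSeries d} (hc : ExpDecay c) :
    hc.toGS.series = c :=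
  funext hc.integral_hermiteSum_mul

theorem ExpDecay.mem_gsSet {d : ℕ} {c : HermiteSeries d} (hc : ExpDecay c) : c ∈ gsSet d :=
  ⟨hc.toGS, hc.series_toGS⟩

theorem ExpDecay.mul_of_mem_gsDualSet {d : ℕ} {m c : HermiteSeries d} (hm : ExpDecay m)
    (hc : c ∈ gsDualSet d) : ExpDecay (m * c) := by
  obtain ⟨r, hr, C, h⟩ := hm
  obtain ⟨K, hK⟩ := exists_norm_le_of_mem_gsDualSet hc (half_pos hr)
  refine ⟨r / 2, half_pos hr, C * K, fun γ => ?_⟩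
  rw [Pi.mul_apply, norm_mul]
  calc _ ≤ (C * Real.exp (-(r * γ.degree))) * (K * Real.exp (r / 2 * γ.degree)) :=
        mul_le_mul (h γ) (hK γ) (norm_nonneg _) ((norm_nonneg _).trans (h γ))
    _ = _ := by
      rw [mul_mul_mul_comm, ← Real.exp_add]
      congr 2
      ring

theorem ExpDecay.const_smul {d : ℕ} {m : HermiteSeries d} (hm : ExpDecay m) (κ : ℂ) :
    ExpDecay (κ • m) := by
  obtain ⟨r, hr, C, h⟩ := hm
  refine ⟨r, hr, ‖κ‖ * C, fun γ => ?_⟩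
  rw [Pi.smul_apply, norm_smul, mul_assoc]
  exact mul_le_mul_of_nonneg_left (h γ) (norm_nonneg _)

/-! ### Multiplier operators -/

theorem hermiteSum_add {d : ℕ} {a b : HermiteSeries d} (ha : ExpDecay a) (hb : ExpDecay b)
    (m : Fin d → ℕ) : hermiteSum (a + b) m = hermiteSum a m + hermiteSum b m := by
  funext x
  simp only [hermiteSum, Pi.add_apply, add_mul]
  exact (ha.summable m x).tsum_add (hb.summable m x)

theorem hermiteSum_smul {d : ℕ} (κ : ℂ) (a : HermiteSeries d) (m : Fin d → ℕ) :
    hermiteSum (κ • a) m = κ • hermiteSum a m := by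
  funext x
  simp only [hermiteSum, Pi.smul_apply, smul_eq_mul, mul_assoc]
  exact tsum_mul_left

/-- A multiplier with exponential decay as a linear map `𝒮_{1/2}'(ℝ^d) → 𝒮_{1/2}(ℝ^d)`. -/
noncomputable def ExpDecay.multiplier {d : ℕ} {m : HermiteSeries d} (hm : ExpDecay m) :
    GelfandShilovDual (1 / 2) d →ₗ[ℂ] GelfandShilov (1 / 2) d where
  toFun u := (hm.mul_of_mem_gsDualSet ⟨u, rfl⟩).toGS
  map_add' u v := Subtype.ext <|
    (congrArg (hermiteSum · 0) (mul_add m (dualSeries u) (dualSeries v))).trans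
      (hermiteSum_add (hm.mul_of_mem_gsDualSet ⟨u, rfl⟩) (hm.mul_of_mem_gsDualSet ⟨v, rfl⟩) 0)
  map_smul' κ u := Subtype.ext <|
    (congrArg (hermiteSum · 0) (mul_smul_comm κ m (dualSeries u))).trans
      (hermiteSum_smul κ (m * dualSeries u) 0)

theorem ExpDecay.continuous_multiplier {d : ℕ} {m : HermiteSeries d} (hm : ExpDecay m) :
    Continuous hm.multiplier := by
  refine (withSeminorms_limitSeminorms (1 / 2) d).continuous_of_continuous_comp _
    fun p => ?_
  obtain ⟨r, hr, C, h⟩ := id hm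
  have hr4 : 0 < r / 4 := by positivity
  obtain ⟨A, H, hA, hH, hg⟩ := exists_gsNorm_hermiteSum_le d hr4
  obtain ⟨K, hK⟩ := p.2 H hH
  set S := ∑' γ : MultiIndex d, C * Real.exp (-(r / 2 * γ.degree)) with hS
  -- A seminorm is continuous once it is bounded on one neighbourhood of $0$.
  refine Seminorm.continuous' (r := K * (A * S)) ?_
  -- The functionals mapping all $e^{-r|\gamma|/4}h_\gamma$ into the unit disc form a strong
  -- neighbourhood of $0$. Of the decay rate $r$, one quarter absorbs $u(h_\gamma)$, one quarter is
  -- the weight in the norm estimate, and $r/2$ remains for summation.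
  have hev := ContinuousLinearMap.eventually_nhds_zero_mapsTo (σ := RingHom.id ℂ)
    (isVonNBounded_dampedHermite d hr4) (Metric.closedBall_mem_nhds (0 : ℂ) one_pos)
  filter_upwards [hev] with u hu
  have hu1 : ∀ γ, ‖dualSeries u γ‖ ≤ Real.exp (r / 4 * γ.degree) := fun γ => by
    have h2 := hu ⟨γ, rfl⟩
    rw [mem_closedBall_zero_iff, dampedHermite, map_smul, norm_smul, Complex.norm_real,
      Real.norm_of_nonneg (Real.exp_pos _).le, Real.exp_neg, inv_mul_le_iff₀ (Real.exp_pos _),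
      mul_one] at h2
    exact h2
  have hle : ∀ γ, ‖(m * dualSeries u) γ‖ * Real.exp (r / 4 * γ.degree) ≤
      C * Real.exp (-(r / 2 * γ.degree)) := fun γ => by
    rw [Pi.mul_apply, norm_mul]
    calc _ ≤ (C * Real.exp (-(r * γ.degree))) * Real.exp (r / 4 * γ.degree) *
          Real.exp (r / 4 * γ.degree) :=
          mul_le_mul_of_nonneg_right (mul_le_mul (h γ) (hu1 γ) (norm_nonneg _)
            ((norm_nonneg _).trans (h γ))) (Real.exp_pos _).le
      _ = _ := by
        rw [mul_assoc, mul_assoc, ← Real.exp_add, ← Real.exp_add]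
        congr 2
        ring
  have hsum : Summable fun γ : MultiIndex d => C * Real.exp (-(r / 2 * γ.degree)) :=
    (summable_exp_neg_degree (half_pos hr)).mul_left C
  have hsu := Summable.of_nonneg_of_le (fun γ => by positivity) hle hsum
  have hc := hm.mul_of_mem_gsDualSet ⟨u, rfl⟩
  have h1 := (hg _ hc hsu).trans (ENNReal.ofReal_le_ofReal
    (mul_le_mul_of_nonneg_left (hsu.tsum_le_tsum hle hsum) hA.le))
  have h2 := (hK (hm.multiplier u) (h1.trans_lt ENNReal.ofReal_lt_top)).trans
    (mul_le_mul_right h1 _)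
  rw [← ENNReal.ofReal_coe_nnreal, ← ENNReal.ofReal_mul K.coe_nonneg] at h2
  have hS0 : 0 ≤ S := tsum_nonneg fun γ => le_trans (by positivity) (hle γ)
  rw [Seminorm.mem_closedBall_zero]
  exact (ENNReal.ofReal_le_ofReal_iff (by positivity)).1 h2

theorem ExpDecay.mapsDualContinuously {d : ℕ} {m : HermiteSeries d} (hm : ExpDecay m) :
    MapsDualContinuously (m * ·) :=
  ⟨⟨hm.multiplier, hm.continuous_multiplier⟩, fun u =>
    (hm.mul_of_mem_gsDualSet ⟨u, rfl⟩).series_toGS⟩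

/-! ### Discontinuity of exponentially growing multipliers -/

theorem series_dampedHermite {d : ℕ} (δ : ℝ) (γ : MultiIndex d) :
    (dampedHermite δ γ).series γ = (Real.exp (-(δ * γ.degree)) : ℂ) := by
  have h : ∀ x, (dampedHermite δ γ).toFun x =
      (Real.exp (-(δ * γ.degree)) : ℂ) * hermiteFun γ x := fun _ => rfl
  simp only [GelfandShilov.series, h, conj_hermiteFun, mul_assoc]
  rw [MeasureTheory.integral_const_mul, integral_hermiteFun_mul, if_pos rfl, mul_one]

/-- The vectors $e^{-rn/3}h_{ne_j}$ serve twice: as a null sequence in the domain and as test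
vectors from a bounded set. Pairing the image of the $n$th with itself gives at least
$ae^{(r-2r/3)n}\ge a$ in modulus, whereas strong convergence would make it smaller than $a$. -/
theorem isDiscontinuousToDual_of_exp_le {d : ℕ} {m : HermiteSeries d} {j : Fin d} {a r : ℝ}
    (ha : 0 < a) (hr : 0 < r) (h : ∀ n : ℕ, a * Real.exp (r * n) ≤ ‖m (Finsupp.single j n)‖) :
    IsDiscontinuousToDual (m * ·) := by
  rintro D hD ⟨T, hT, hTs⟩
  have hr3 : 0 < r / 3 := by positivity
  have h0 : (0 : GelfandShilov (1 / 2) d) ∈ D := hD (finiteHermite d).zero_mem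
  have hmem : ∀ γ, dampedHermite (r / 3) γ ∈ D := fun γ =>
    hD ((finiteHermite d).smul_mem _ (Submodule.subset_span ⟨γ, rfl⟩))
  -- `T` need not be linear, hence the difference with `T 0`, whose Hermite coefficients vanish.
  have hlim : Filter.Tendsto (fun n : ℕ => T (dampedHermite (r / 3) (Finsupp.single j n)) - T 0)
      Filter.atTop (nhds 0) := by
    have h1 := (hT 0 h0).tendsto.comp (tendsto_nhdsWithin_iff.2
      ⟨tendsto_dampedHermite hr3 j, Filter.Eventually.of_forall fun n => hmem _⟩)
    simpa using h1.sub_const (T 0)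
  have hev := hlim.eventually (ContinuousLinearMap.eventually_nhds_zero_mapsTo (σ := RingHom.id ℂ)
    (isVonNBounded_dampedHermite d hr3) (Metric.ball_mem_nhds (0 : ℂ) ha))
  obtain ⟨n, hn⟩ := hev.exists
  have h2 := hn ⟨Finsupp.single j n, rfl⟩
  have hT0 : T 0 (hermiteGS (Finsupp.single j n)) = 0 := by
    have h3 := congrFun (hTs 0 h0) (Finsupp.single j n)
    have h4 : (0 : GelfandShilov (1 / 2) d).series (Finsupp.single j n) = 0 := by
      have : ∀ x, (0 : GelfandShilov (1 / 2) d).toFun x = 0 := fun _ => rfl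
      simp [GelfandShilov.series, this]
    beta_reduce at h3
    rw [Pi.mul_apply, h4, mul_zero] at h3
    exact h3
  have hTn : T (dampedHermite (r / 3) (Finsupp.single j n)) (hermiteGS (Finsupp.single j n)) =
      m (Finsupp.single j n) * (Real.exp (-(r / 3 * n)) : ℂ) := by
    have h3 := congrFun (hTs _ (hmem (Finsupp.single j n))) (Finsupp.single j n)
    beta_reduce at h3
    rw [Pi.mul_apply, series_dampedHermite, Finsupp.degree_single] at h3
    exact h3
  -- Only the test vector is unfolded; the argument of `T` stays intact so that `hTn` applies.
  nth_rewrite 2 [dampedHermite] at h2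
  rw [map_smul, _root_.sub_apply, hT0, hTn, sub_zero, Finsupp.degree_single,
    mem_ball_zero_iff, norm_smul, norm_mul, Complex.norm_real,
    Real.norm_of_nonneg (Real.exp_pos _).le] at h2
  have h5 : a ≤ Real.exp (-(r / 3 * n)) * (a * Real.exp (r * n) * Real.exp (-(r / 3 * n))) := by
    have e : Real.exp (-(r / 3 * n)) * (a * Real.exp (r * n) * Real.exp (-(r / 3 * n))) =
        a * Real.exp (r / 3 * n) := by
      rw [mul_assoc a, mul_left_comm, ← Real.exp_add, ← Real.exp_add]
      congr 2
      ring
    rw [e]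
    exact le_mul_of_one_le_right ha.le (Real.one_le_exp (by positivity))
  refine absurd h2 (not_lt.2 (h5.trans ?_))
  gcongr
  exact h n

theorem smul_mem_gsDualSet {d : ℕ} (κ : ℂ) {c : HermiteSeries d} (hc : c ∈ gsDualSet d) :
    κ • c ∈ gsDualSet d := by
  obtain ⟨u, rfl⟩ := hc
  exact ⟨κ • u, rfl⟩

theorem smul_mem_gsSet {d : ℕ} (κ : ℂ) {c : HermiteSeries d} (hc : c ∈ gsSet d) :
    κ • c ∈ gsSet d := by
  obtain ⟨f, rfl⟩ := hc
  refine ⟨κ • f, funext fun γ => ?_⟩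
  have h : ∀ x, (κ • f).toFun x = κ * f.toFun x := fun _ => rfl
  simp only [GelfandShilov.series, h, mul_assoc, Pi.smul_apply, smul_eq_mul]
  exact MeasureTheory.integral_const_mul _ _

/-- A nonzero constant can be moved from the multiplier into $S$; this is why the two operators have
equal images. -/
theorem image_smul_mul_eq {d : ℕ} {S : Set (HermiteSeries d)}
    (hS : ∀ (κ : ℂ) (c : HermiteSeries d), c ∈ S → κ • c ∈ S) {κ : ℂ} (hκ : κ ≠ 0)
    (m : HermiteSeries d) : (m * ·) '' S = ((κ • m) * ·) '' S := by
  ext c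
  constructor
  · rintro ⟨b, hb, rfl⟩
    refine ⟨κ⁻¹ • b, hS _ _ hb, ?_⟩
    simp only [smul_mul_smul_comm, mul_inv_cancel₀ hκ, one_smul]
  · rintro ⟨b, hb, rfl⟩
    exact ⟨κ • b, hS _ _ hb, by simp only [mul_smul_comm, smul_mul_assoc]⟩

theorem not_exp_le_exp {s r : ℝ} (h : s < r) (C : ℝ) :
    ¬ ∀ n : ℕ, Real.exp (r * n) ≤ C * Real.exp (s * n) := by
  intro h1
  have h2 : Filter.Tendsto (fun n : ℕ => Real.exp ((r - s) * n)) Filter.atTop Filter.atTop :=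
    Real.tendsto_exp_atTop.comp
      (tendsto_natCast_atTop_atTop.const_mul_atTop (sub_pos.2 h))
  obtain ⟨n, hn⟩ := (h2.eventually_gt_atTop C).exists
  refine absurd (h1 n) (not_le.2 ?_)
  rw [sub_mul, Real.exp_sub, lt_div_iff₀ (Real.exp_pos _)] at hn
  exact hn

theorem mem_pilipovicBeurlingDual_half {d : ℕ} {c : HermiteSeries d} :
    c ∈ pilipovicBeurlingDual (1 / 2) d ↔
      ∃ r : ℝ, 0 < r ∧ ∃ C : ℝ, ∀ γ, ‖c γ‖ ≤ C * Real.exp (r * γ.degree) := by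
  simp only [pilipovicBeurlingDual, Set.mem_ofPred_eq]
  norm_num

theorem mul_mem_pilipovicBeurlingDual_half {d : ℕ} {a b : HermiteSeries d}
    (ha : a ∈ pilipovicBeurlingDual (1 / 2) d) (hb : b ∈ pilipovicBeurlingDual (1 / 2) d) :
    a * b ∈ pilipovicBeurlingDual (1 / 2) d := by
  rw [mem_pilipovicBeurlingDual_half] at *
  obtain ⟨r, hr, C, h⟩ := ha
  obtain ⟨s, hs, K, hK⟩ := hb
  refine ⟨r + s, by positivity, C * K, fun γ => ?_⟩
  rw [Pi.mul_apply, norm_mul, add_mul, Real.exp_add, mul_mul_mul_comm]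
  exact mul_le_mul (h γ) (hK γ) (norm_nonneg _) ((norm_nonneg _).trans (h γ))

/-! ### The multiplier of the fractional Fourier transform -/

/-- The factor `e^{-iπ⟨γ, ϱ⟩/2}` by which `ℱ_ϱ` multiplies the coefficient of `h_γ`. -/
noncomputable def fracMultiplier {d : ℕ} (ϱ : Fin d → ℂ) : HermiteSeries d :=
  fun γ => ∏ j, Complex.exp (-(Complex.I * Real.pi * ϱ j / 2)) ^ γ j

/-- Rescaling the variables acts diagonally on monomials, and the factors $\sqrt{\gamma!}$ of the
Bargmann transform and its inverse cancel. -/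
theorem fracFourier_eq {d : ℕ} (ϱ : Fin d → ℂ) : fracFourier ϱ = (fracMultiplier ϱ * ·) := by
  funext c γ
  have h0 : ((√(mfact γ : ℝ) : ℝ) : ℂ) ≠ 0 := by
    exact_mod_cast (Real.sqrt_pos.2 (mfact_pos γ)).ne'
  have h1 : MvPowerSeries.coeff γ (bargmann d c) = c γ / ((√(mfact γ : ℝ) : ℝ) : ℂ) := rfl
  change ((√(mfact γ : ℝ) : ℝ) : ℂ) * MvPowerSeries.coeff γ (MvPowerSeries.rescale _ _) = _
  rw [MvPowerSeries.coeff_rescale, h1, Pi.mul_apply, fracMultiplier, Finsupp.prod_fintype]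
  · field_simp
  · simp

theorem propagator_eq {d : ℕ} (ϱ : Fin d → ℂ) :
    propagator (-(Complex.I * Real.pi / 4)) ϱ =
      ((Complex.exp (-(Complex.I * Real.pi / 4) * ∑ j, ϱ j) • fracMultiplier ϱ) * ·) := by
  funext c γ
  have e : ∑ j, (γ j : ℂ) * -(Complex.I * Real.pi * ϱ j / 2) =
      -(Complex.I * Real.pi / 4) * (2 * ∑ j, (γ j : ℂ) * ϱ j) := by
    rw [Finset.mul_sum, Finset.mul_sum]
    exact Finset.sum_congr rfl fun j _ => by ring
  simp only [propagator, Pi.mul_apply, Pi.smul_apply, smul_eq_mul, fracMultiplier, oscEigenvalue,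
    ← Complex.exp_nat_mul, ← Complex.exp_sum, ← Complex.exp_add]
  rw [e, ← mul_add, add_comm]

theorem norm_fracMultiplier {d : ℕ} (ϱ : Fin d → ℂ) (γ : MultiIndex d) :
    ‖fracMultiplier ϱ γ‖ = Real.exp (Real.pi / 2 * ∑ j, (ϱ j).im * γ j) := by
  rw [fracMultiplier, norm_prod, Finset.mul_sum, Real.exp_sum]
  refine Finset.prod_congr rfl fun j _ => ?_
  rw [norm_pow, Complex.norm_exp, ← Real.exp_nat_mul]
  congr 1
  simp
  ring

theorem norm_fracMultiplier_single {d : ℕ} (ϱ : Fin d → ℂ) (j : Fin d) (n : ℕ) :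
    ‖fracMultiplier ϱ (Finsupp.single j n)‖ = Real.exp (Real.pi / 2 * (ϱ j).im * n) := by
  rw [norm_fracMultiplier, Finset.sum_eq_single j]
  · rw [Finsupp.single_eq_same, mul_assoc]
  · intro k _ hk
    rw [Finsupp.single_eq_of_ne hk, Nat.cast_zero, mul_zero]
  · simp

theorem fracMultiplier_mul_neg {d : ℕ} (ϱ : Fin d → ℂ) :
    fracMultiplier ϱ * fracMultiplier (-ϱ) = 1 := by
  funext γ
  simp only [Pi.mul_apply, fracMultiplier, ← Finset.prod_mul_distrib, ← mul_pow,
    ← Complex.exp_add, Pi.neg_apply, Pi.one_apply]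
  refine Finset.prod_eq_one fun j _ => ?_
  rw [show -(Complex.I * Real.pi * ϱ j / 2) + -(Complex.I * Real.pi * -ϱ j / 2) = 0 by ring,
    Complex.exp_zero, one_pow]

theorem expDecay_of_norm_eq {d : ℕ} (hd : 0 < d) {ϱ : Fin d → ℂ} (hϱ : ∀ j, (ϱ j).im < 0)
    {s : ℝ} (hs : 0 < s) {c : HermiteSeries d}
    (hc : ∀ γ, ‖c γ‖ = Real.exp (s * ∑ j, (ϱ j).im * γ j)) : ExpDecay c := by
  have : Nonempty (Fin d) := ⟨⟨0, hd⟩⟩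
  -- The largest, hence least negative, imaginary part fixes the decay rate; $d>0$ ensures that it
  -- exists.
  obtain ⟨k, hk⟩ := Finite.exists_max fun j => (ϱ j).im
  refine ⟨s * -(ϱ k).im, mul_pos hs (neg_pos.2 (hϱ k)), 1, fun γ => ?_⟩
  rw [hc, one_mul, Real.exp_le_exp, mul_assoc, ← mul_neg, neg_mul, neg_neg, Finsupp.degree_eq_sum]
  push_cast
  rw [Finset.mul_sum Finset.univ (fun j => (γ j : ℝ))]
  gcongr with j _
  exact hk j

theorem fracMultiplier_mem_pilipovicBeurlingDual {d : ℕ} (ϱ : Fin d → ℂ) :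
    fracMultiplier ϱ ∈ pilipovicBeurlingDual (1 / 2) d := by
  rw [mem_pilipovicBeurlingDual_half]
  refine ⟨Real.pi / 2 * (∑ j, |(ϱ j).im| + 1), by positivity, 1, fun γ => ?_⟩
  rw [norm_fracMultiplier, one_mul, Real.exp_le_exp, mul_assoc, Finsupp.degree_eq_sum]
  push_cast
  rw [Finset.mul_sum Finset.univ (fun j => (γ j : ℝ))]
  gcongr with j _
  refine (le_abs_self _).trans ((Finset.single_le_sum (f := fun j => |(ϱ j).im|)
    (fun _ _ => abs_nonneg _) (Finset.mem_univ j)).trans (le_add_of_nonneg_right zero_le_one))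

theorem gsSet_subset_pilipovicBeurlingDual {d : ℕ} {c : HermiteSeries d} (hc : c ∈ gsSet d) :
    c ∈ pilipovicBeurlingDual (1 / 2) d := by
  obtain ⟨C, h⟩ := exists_norm_le_of_mem_gsSet hc
  exact mem_pilipovicBeurlingDual_half.2 ⟨1, one_pos, C, fun γ => by rw [one_mul]; exact h γ⟩

theorem smul_mem_pilipovicBeurlingDual_half {d : ℕ} (κ : ℂ) {c : HermiteSeries d}
    (hc : c ∈ pilipovicBeurlingDual (1 / 2) d) : κ • c ∈ pilipovicBeurlingDual (1 / 2) d := by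
  rw [mem_pilipovicBeurlingDual_half] at *
  obtain ⟨r, hr, C, h⟩ := hc
  refine ⟨r, hr, ‖κ‖ * C, fun γ => ?_⟩
  rw [Pi.smul_apply, norm_smul, mul_assoc]
  exact mul_le_mul_of_nonneg_left (h γ) (norm_nonneg _)

/-- If `Im ϱ_j > 0`, then `ℱ_ϱ` moves some element of `𝒮_{1/2}(ℝ^d)` out of `𝒮_{1/2}'(ℝ^d)`. -/
theorem exists_expDecay_not_mem_gsDualSet {d : ℕ} {ϱ : Fin d → ℂ} {j : Fin d}
    (hj : 0 < (ϱ j).im) : ∃ c : HermiteSeries d, ExpDecay c ∧ fracMultiplier ϱ * c ∉ gsDualSet d := by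
  -- Half the growth rate of the multiplier along $ne_j$: the product still grows like $e^{sn}$
  -- there, against the bound $Ce^{sn/2}$.
  set s := Real.pi / 4 * (ϱ j).im with hs
  have hs0 : 0 < s := by positivity
  refine ⟨fun γ => (Real.exp (-(s * γ.degree)) : ℂ), ⟨s, hs0, 1, fun γ => ?_⟩, fun hmem => ?_⟩
  · rw [Complex.norm_real, Real.norm_of_nonneg (Real.exp_pos _).le, one_mul]
  · obtain ⟨C, hC⟩ := exists_norm_le_of_mem_gsDualSet hmem (half_pos hs0)
    refine not_exp_le_exp (half_lt_self hs0) C fun n => ?_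
    have h := hC (Finsupp.single j n)
    rw [Pi.mul_apply, norm_mul, norm_fracMultiplier_single, Complex.norm_real,
      Real.norm_of_nonneg (Real.exp_pos _).le, ← Real.exp_add, Finsupp.degree_single] at h
    convert h using 2
    rw [hs]
    ring

theorem isDiscontinuousToDual_smul_fracMultiplier {d : ℕ} {ϱ : Fin d → ℂ} {j : Fin d}
    (hj : 0 < (ϱ j).im) {κ : ℂ} (hκ : κ ≠ 0) :
    IsDiscontinuousToDual ((κ • fracMultiplier ϱ) * ·) := by
  refine isDiscontinuousToDual_of_exp_le (j := j) (norm_pos_iff.2 hκ)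
    (r := Real.pi / 2 * (ϱ j).im) (by positivity) fun n => ?_
  rw [Pi.smul_apply, norm_smul, norm_fracMultiplier_single]

/-! ### Images under the fractional Fourier transform -/

theorem fracFourier_image_gsDualSet_ssubset {d : ℕ} (hd : 0 < d) {ϱ : Fin d → ℂ}
    (hϱ : ∀ j, (ϱ j).im < 0) : (fracMultiplier ϱ * ·) '' gsDualSet d ⊂ gsSet d := by
  have hm : ExpDecay (fracMultiplier ϱ) :=
    expDecay_of_norm_eq hd hϱ (by positivity) (norm_fracMultiplier ϱ)
  refine ⟨?_, fun hsub => ?_⟩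
  · rintro _ ⟨c, hc, rfl⟩
    exact (hm.mul_of_mem_gsDualSet hc).mem_gsSet
  · set j : Fin d := ⟨0, hd⟩
    -- This is $|m|^{1/2}$: it decays, but a preimage has modulus $|m|^{-1/2}$, which grows
    -- exponentially.
    set c : HermiteSeries d := fun γ => (Real.exp (Real.pi / 4 * ∑ j, (ϱ j).im * γ j) : ℂ) with hc
    have hcn : ∀ γ, ‖c γ‖ = Real.exp (Real.pi / 4 * ∑ j, (ϱ j).im * γ j) := fun γ => by
      rw [hc, Complex.norm_real, Real.norm_of_nonneg (Real.exp_pos _).le]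
    obtain ⟨u, hu, huc⟩ := hsub (expDecay_of_norm_eq hd hϱ (by positivity) hcn).mem_gsSet
    set s := Real.pi / 4 * -(ϱ j).im with hs
    have hs0 : 0 < s := mul_pos (by positivity) (neg_pos.2 (hϱ j))
    obtain ⟨C, hC⟩ := exists_norm_le_of_mem_gsDualSet hu (half_pos hs0)
    refine not_exp_le_exp (half_lt_self hs0) C fun n => ?_
    have h1 := hC (Finsupp.single j n)
    rw [Finsupp.degree_single] at h1
    refine le_trans (le_of_eq ?_) h1
    have h2 := congrArg norm (congrFun huc (Finsupp.single j n))
    have h3 : ∑ k, (ϱ k).im * (Finsupp.single j n k : ℝ) = (ϱ j).im * n := by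
      rw [Finset.sum_eq_single j]
      · rw [Finsupp.single_eq_same]
      · intro k _ hk
        rw [Finsupp.single_eq_of_ne hk, Nat.cast_zero, mul_zero]
      · simp
    beta_reduce at h2
    rw [Pi.mul_apply, norm_mul, norm_fracMultiplier_single, hcn, h3] at h2
    refine mul_left_cancel₀ (Real.exp_pos _).ne' (Eq.trans ?_ h2.symm)
    rw [← Real.exp_add, hs]
    congr 1
    ring

/-- The inverse multiplier belongs to $-\varrho$ and decays, so it sends $\mathcal S_{1/2}'$ into
$\mathcal S_{1/2}$ and supplies the preimages. -/
theorem gsDualSet_ssubset_fracFourier_image {d : ℕ} (hd : 0 < d) {ϱ : Fin d → ℂ}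
    (hϱ : ∀ j, 0 < (ϱ j).im) : gsDualSet d ⊂ (fracMultiplier ϱ * ·) '' gsSet d := by
  have hm : ExpDecay (fracMultiplier (-ϱ)) :=
    expDecay_of_norm_eq hd (fun j => by simpa using hϱ j) (by positivity)
      (norm_fracMultiplier (-ϱ))
  refine ⟨fun c hc => ⟨_, (hm.mul_of_mem_gsDualSet hc).mem_gsSet, ?_⟩, fun hsub => ?_⟩
  · simp only [← mul_assoc, fracMultiplier_mul_neg, one_mul]
  · obtain ⟨c, hc, hcd⟩ := exists_expDecay_not_mem_gsDualSet (hϱ ⟨0, hd⟩)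
    exact hcd (hsub ⟨c, hc.mem_gsSet, rfl⟩)

theorem fracFourier_image_gsSet_ssubset {d : ℕ} (hd : 0 < d) (ϱ : Fin d → ℂ) :
    (fracMultiplier ϱ * ·) '' gsSet d ⊂ pilipovicBeurlingDual (1 / 2) d := by
  refine ⟨?_, fun hsub => ?_⟩
  · rintro _ ⟨c, hc, rfl⟩
    exact mul_mem_pilipovicBeurlingDual_half (fracMultiplier_mem_pilipovicBeurlingDual ϱ)
      (gsSet_subset_pilipovicBeurlingDual hc)
  -- The rate $2$ only has to exceed the rate $1$ of `exists_norm_le_of_mem_gsSet`. The witness is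
  -- $m\,c$, whose only preimage is $c$ because $m$ is invertible.
  · set c : HermiteSeries d := fun γ => (Real.exp (2 * γ.degree) : ℂ) with hc
    have hcn : ∀ γ, ‖c γ‖ = Real.exp (2 * γ.degree) := fun γ => by
      rw [hc, Complex.norm_real, Real.norm_of_nonneg (Real.exp_pos _).le]
    have hcB : c ∈ pilipovicBeurlingDual (1 / 2) d :=
      mem_pilipovicBeurlingDual_half.2 ⟨2, two_pos, 1, fun γ => by rw [hcn, one_mul]⟩
    obtain ⟨b, hb, hbc⟩ := hsub (mul_mem_pilipovicBeurlingDual_half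
      (fracMultiplier_mem_pilipovicBeurlingDual ϱ) hcB)
    have hbc' : b = c := by
      have h := congrArg (fracMultiplier (-ϱ) * ·) hbc
      have e : fracMultiplier (-ϱ) * fracMultiplier ϱ = 1 := by
        rw [mul_comm, fracMultiplier_mul_neg]
      simpa only [← mul_assoc, e, one_mul] using h
    obtain ⟨C, hC⟩ := exists_norm_le_of_mem_gsSet hb
    refine not_exp_le_exp (one_lt_two (α := ℝ)) C fun n => ?_
    have h := hC (Finsupp.single ⟨0, hd⟩ n)
    rwa [hbc', hcn, Finsupp.degree_single, ← one_mul (n : ℝ), mul_left_comm, one_mul] at h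

end FracFourier

/-! ### The three claims for the multipliers $m$ and $\kappa m$ -/

theorem proposition0p3 (d : ℕ) (hd : 0 < d) (ϱ : Fin d → ℂ) :
    ((∀ j, (ϱ j).im < 0) →
      FracFourier.MapsDualContinuously (FracFourier.fracFourier ϱ) ∧
      FracFourier.MapsDualContinuously
        (FracFourier.propagator (-(Complex.I * Real.pi / 4)) ϱ) ∧
      FracFourier.fracFourier ϱ '' FracFourier.gsDualSet d =
        FracFourier.propagator (-(Complex.I * Real.pi / 4)) ϱ '' FracFourier.gsDualSet d ∧
      FracFourier.fracFourier ϱ '' FracFourier.gsDualSet d ⊂ FracFourier.gsSet d) ∧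
    ((∀ j, 0 < (ϱ j).im) →
      FracFourier.IsDiscontinuousToDual (FracFourier.fracFourier ϱ) ∧
      FracFourier.IsDiscontinuousToDual
        (FracFourier.propagator (-(Complex.I * Real.pi / 4)) ϱ) ∧
      FracFourier.gsDualSet d ⊂ FracFourier.fracFourier ϱ '' FracFourier.gsSet d ∧
      FracFourier.fracFourier ϱ '' FracFourier.gsSet d =
        FracFourier.propagator (-(Complex.I * Real.pi / 4)) ϱ '' FracFourier.gsSet d ∧
      FracFourier.fracFourier ϱ '' FracFourier.gsSet d ⊂
        FracFourier.pilipovicBeurlingDual (1 / 2) d) ∧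
    ((∃ j, 0 < (ϱ j).im) →
      FracFourier.IsDiscontinuousToDual (FracFourier.fracFourier ϱ) ∧
      FracFourier.IsDiscontinuousToDual
        (FracFourier.propagator (-(Complex.I * Real.pi / 4)) ϱ) ∧
      ∃ f : FracFourier.GelfandShilov (1 / 2) d,
        FracFourier.fracFourier ϱ f.series ∈
          FracFourier.pilipovicBeurlingDual (1 / 2) d \ FracFourier.gsDualSet d ∧
        FracFourier.propagator (-(Complex.I * Real.pi / 4)) ϱ f.series ∈
          FracFourier.pilipovicBeurlingDual (1 / 2) d \ FracFourier.gsDualSet d) := by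
  have hκ : Complex.exp (-(Complex.I * Real.pi / 4) * ∑ j, ϱ j) ≠ 0 := Complex.exp_ne_zero _
  rw [FracFourier.fracFourier_eq, FracFourier.propagator_eq]
  set κ := Complex.exp (-(Complex.I * Real.pi / 4) * ∑ j, ϱ j)
  have hdisc : ∀ j, 0 < (ϱ j).im →
      FracFourier.IsDiscontinuousToDual (FracFourier.fracMultiplier ϱ * ·) ∧
      FracFourier.IsDiscontinuousToDual ((κ • FracFourier.fracMultiplier ϱ) * ·) := by
    refine fun j hj => ⟨?_, FracFourier.isDiscontinuousToDual_smul_fracMultiplier hj hκ⟩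
    have h := FracFourier.isDiscontinuousToDual_smul_fracMultiplier hj one_ne_zero
    rwa [one_smul] at h
  refine ⟨fun h => ?_, fun h => ?_, ?_⟩
  · have hm : FracFourier.ExpDecay (FracFourier.fracMultiplier ϱ) :=
      FracFourier.expDecay_of_norm_eq hd h (by positivity) (FracFourier.norm_fracMultiplier ϱ)
    exact ⟨hm.mapsDualContinuously, (hm.const_smul κ).mapsDualContinuously,
      FracFourier.image_smul_mul_eq (fun _ _ => FracFourier.smul_mem_gsDualSet _) hκ _,
      FracFourier.fracFourier_image_gsDualSet_ssubset hd h⟩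
  · exact ⟨(hdisc _ (h ⟨0, hd⟩)).1, (hdisc _ (h ⟨0, hd⟩)).2,
      FracFourier.gsDualSet_ssubset_fracFourier_image hd h,
      FracFourier.image_smul_mul_eq (fun _ _ => FracFourier.smul_mem_gsSet _) hκ _,
      FracFourier.fracFourier_image_gsSet_ssubset hd ϱ⟩
  · rintro ⟨j, hj⟩
    obtain ⟨c, hc, hcd⟩ := FracFourier.exists_expDecay_not_mem_gsDualSet hj
    have hB := (FracFourier.fracFourier_image_gsSet_ssubset hd ϱ).1 ⟨c, hc.mem_gsSet, rfl⟩
    refine ⟨(hdisc j hj).1, (hdisc j hj).2, hc.toGS, ?_⟩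
    rw [hc.series_toGS]
    refine ⟨⟨hB, hcd⟩, ?_⟩
    simp only [smul_mul_assoc]
    refine ⟨FracFourier.smul_mem_pilipovicBeurlingDual_half κ hB, fun hmem => hcd ?_⟩
    -- The propagator's image of $f$ is $\kappa$ times that under $\mathscr F_\varrho$, and
    -- $\mathcal S_{1/2}'$ is stable under scalars.
    have h := FracFourier.smul_mem_gsDualSet κ⁻¹ hmem
    rwa [smul_smul, inv_mul_cancel₀ hκ, one_smul] at h
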